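/- Setting. Let $G=(V,E)$ be a directed network with finitely many links, $\mathcal P$ the set of loop-free paths from a source to a destination (each path $p$ identified with its set of links), $H=\max_{p\in\mathcal P}|p|$, and $\theta\in(0,1]^E$. For $k\ge 1$ and $i\in E$, the delay of the $k$-th packet on link $i$ is geometric on $\{1,2,\dots\}$ with success probability $\theta_i$, and all these delays are mutually independent. Paths $p(1),p(2),\dots\in\mathcal P$ of successive packets are chosen by an arbitrary source-routing policy with semi-bandit feedback: $p(n)$ is a function of the earlier paths, of the delays observed on the links of these paths, and of a randomization independent of the delays. Let $s_i(n)$ be the number of packets routed through link $i$ before the $n$-th packet is sent, $t_i(n)$ the total number of transmission attempts on link $i$ (the sum of the delays of these packets), and $\hat\theta_i(n)=s_i(n)/t_i(n)$ ($=0$ if $t_i(n)=0$). Write $p^\top u^{-1}=\sum_{i\in p}1/u_i$, let $\mathrm{KL}(a,b)\in[0,\infty]$ be the Kullback–Leibler divergence between the Bernoulli laws with means $a$ and $b$, and let $f_1(n)=\log n+4H\log\log n$ (with $\log 0=-\infty$). For nonnegative vectors $t$ and $s$ define $$b_p(n,\lambda)=\inf\Big\{p^\top u^{-1}:\ u\in(0,1]^E,\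 \sum_{i\in p}t_i\,\mathrm{KL}(\lambda_i,u_i)\le f_1(n)\Big\},\qquad c_p(n,\lambda)=p^\top\lambda^{-1}-\sqrt{\frac{f_1(n)}2\sum_{i\in p}\frac1{s_i\lambda_i^3}},$$ where $\inf\emptyset=+\infty$, $0\cdot\infty=0$, $1/0=\infty$, and the square root is read as $0$ when $f_1(n)<0$ (then $b_p(n,\lambda)=+\infty$). Theorem. (i) For all $n\ge1$, $p\in\mathcal P$, $\lambda\in(0,1]^E$ and all real vectors $t,s\ge 0$ with $s_i=t_i\lambda_i$ for $i\in p$ (that is, $\lambda_i=s_i/t_i$ wherever $t_i>0$), one has $b_p(n,\lambda)\ge c_p(n,\lambda)$. (ii) There is $K_H>0$ depending only on $H$ (not on the network, $\theta$, the policy, $n$ or $p$) such that for all $p\in\mathcal P$ and $n\ge1$, with $t=t(n)$ in the definition of $b_p$, $$\mathbb P\big[b_p(n,\hat\theta(n))>p^\top\theta^{-1}\big]\le K_H\,n^{-1}(\log n)^{-2},$$ and, if moreover $\theta_i<1$ for at least one $i\in p$, also $$\mathbb P\big[b_p(n,\hat\theta(n))\ge p^\top\theta^{-1}\big]\le K_H\,n^{-1}(\log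 n)^{-2}$$ (the right-hand sides are $+\infty$ at $n=1$). -/

import Mathlib

open MeasureTheory ProbabilityTheory
open scoped ENNReal

namespace Routing

noncomputable section

/-! ### Networks and loop-free paths -/

/-- A directed network with nodes `V` and links `E` (parallel links are allowed), together with a
source node and a destination node. -/
structure Network (V E : Type*) where
  /-- tail of a link -/
  tail : E → V
  /-- head of a link -/
  head : E → V
  /-- source of the packets -/
  source : V
  /-- destination of the packets -/
  dest : V

/-- The list of links `l` is a walk from `a` to `b`. -/
def Network.IsWalk {V E : Type*} (G : Network V E) (b : V) : V → List E → Prop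
  | a, [] => a = b
  | a, e :: l => G.tail e = a ∧ G.IsWalk b (G.head e) l

/-- The list of links `l` is a path from the source to the destination that visits no node
twice. -/
def Network.IsLoopFreePath {V E : Type*} (G : Network V E) (l : List E) : Prop :=
  G.IsWalk G.dest G.source l ∧ (G.source :: l.map G.head).Nodup

open Classical in
/-- The set `𝒫` of loop-free paths from the source to the destination; a path is identified with
the set of its links, that is, with a `0`-`1` vector indexed by the links. -/
def Network.paths {V E : Type*} [Fintype E] (G : Network V E) : Finset (Finset E) :=
  Finset.univ.filter fun p => ∃ l : List E, G.IsLoopFreePath l ∧ l.toFinset = p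

/-- The maximal number `H` of links of a loop-free path. -/
def Network.maxLength {V E : Type*} [Fintype E] (G : Network V E) : ℕ :=
  G.paths.sup Finset.card

/-! ### The two path indexes -/

/-- The Kullback-Leibler divergence between the Bernoulli distributions with means `a` and `b`
(`a, b ∈ [0, 1]`), with the usual conventions `0 log 0 = 0` and `x log (x / 0) = ∞` for
`x > 0`. -/
def klBer (a b : ℝ) : ℝ≥0∞ :=
  if (b = 1 ∧ a ≠ 1) ∨ (b = 0 ∧ a ≠ 0) then ⊤
  else ENNReal.ofReal (a * Real.log (a / b) + (1 - a) * Real.log ((1 - a) / (1 - b)))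

/-- `f₁(n) = log n + 4 H log (log n)`, with `log 0 = -∞` (which matters at `n = 1`). -/
def f1 (H n : ℕ) : EReal :=
  ((Real.log n : ℝ) : EReal) +
    ((4 * H : ℝ) : EReal) * ENNReal.log (ENNReal.ofReal (Real.log n))

/-- The average delay `pᵀ u⁻¹` of the path `p` when the link success probabilities are `u`. -/
def pathDelay {E : Type*} (p : Finset E) (u : E → ℝ) : ℝ := ∑ i ∈ p, (u i)⁻¹

/-- The index `b_p(n, x)`: the infimum of `pᵀ u⁻¹` over the `u ∈ (0, 1]^E` such that
`∑_{i ∈ p} t_i KL(x_i, u_i) ≤ f₁(n)`, where `t_i` is the number of transmission attempts on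
link `i`. The infimum of the empty set is `+∞`, and `0 * ∞ = 0` in the constraint. -/
def indexB {E : Type*} (H : ℕ) (p : Finset E) (n : ℕ) (t x : E → ℝ) : EReal :=
  sInf {v : EReal | ∃ u : E → ℝ, (∀ i, 0 < u i ∧ u i ≤ 1) ∧
    ((∑ i ∈ p, ENNReal.ofReal (t i) * klBer (x i) (u i) : ℝ≥0∞) : EReal) ≤ f1 H n ∧
    v = ((pathDelay p u : ℝ) : EReal)}

/-- The index `c_p(n, x) = pᵀ x⁻¹ - √(f₁(n) / 2 * ∑_{i ∈ p} 1 / (s_i x_i³))`, where `s_i` is the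
number of packets sent through link `i`. Here `1 / 0 = ∞`, and the square root is taken to
be `0` if `f₁(n) < 0`. -/
def indexC {E : Type*} (H : ℕ) (p : Finset E) (n : ℕ) (s x : E → ℝ) : EReal :=
  ((pathDelay p x : ℝ) : EReal) -
    ((((f1 H n).toENNReal / 2 * ∑ i ∈ p, (ENNReal.ofReal (s i * x i ^ 3))⁻¹) ^ (1 / 2 : ℝ) :
      ℝ≥0∞) : EReal)

/-! ### Source routing with semi-bandit feedback -/

/-- What the source records about a packet: the path used and the delays on the links of this path
(the entries of the links that were not used are `0`). -/
abbrev Record (E : Type*) : Type _ := Finset E × (E → ℕ)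

/-- A source-routing policy with semi-bandit feedback: the path of the next packet is a function
of the records of all previous packets (oldest first) and of an external randomization, a point
of the measurable space `W`. -/
structure Policy {V E : Type*} [Fintype E] (G : Network V E) (W : Type*) [MeasurableSpace W] where
  /-- the path chosen for the next packet -/
  choose : W → List (Record E) → Finset E
  choose_mem : ∀ w h, choose w h ∈ G.paths
  measurableSet_choose : ∀ h q, MeasurableSet {w | choose w h = q}

variable {V E : Type*} [Fintype E] [DecidableEq E] {G : Network V E}
  {W : Type*} [MeasurableSpace W]

/-- The records of packets `1, …, m` under the policy `π`, with randomization `w`, when the `k`-th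
packet needs `d k i` transmission attempts if it is sent over link `i`. -/
def Policy.history (π : Policy G W) (w : W) (d : ℕ → E → ℕ) : ℕ → List (Record E)
  | 0 => []
  | m + 1 =>
    let q := π.choose w (π.history w d m)
    π.history w d m ++ [(q, fun i => if i ∈ q then d (m + 1) i else 0)]

/-- The path of the `n`-th packet (`n ≥ 1`). -/
def Policy.path (π : Policy G W) (w : W) (d : ℕ → E → ℕ) (n : ℕ) : Finset E :=
  π.choose w (π.history w d (n - 1))

/-- `s_i(n)`: the number of packets routed through link `i` before the `n`-th packet is sent. -/
def Policy.packets (π : Policy G W) (w : W) (d : ℕ → E → ℕ) (n : ℕ) (i : E) : ℕ :=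
  ∑ k ∈ Finset.Ico 1 n, if i ∈ π.path w d k then 1 else 0

/-- `t_i(n)`: the number of transmission attempts on link `i` before the `n`-th packet is sent. -/
def Policy.attempts (π : Policy G W) (w : W) (d : ℕ → E → ℕ) (n : ℕ) (i : E) : ℕ :=
  ∑ k ∈ Finset.Ico 1 n, if i ∈ π.path w d k then d k i else 0

/-- The empirical success probability `s_i(n) / t_i(n)`, which is `0` if `t_i(n) = 0`. -/
def Policy.empirical (π : Policy G W) (w : W) (d : ℕ → E → ℕ) (n : ℕ) (i : E) : ℝ :=
  (π.packets w d n i : ℝ) / (π.attempts w d n i : ℝ)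

/-- The stochastic model: the delays `d k i` of the packets `k` on the links `i` are mutually
independent, `d k i` is geometric on `{1, 2, …}` with success probability `θ i`, and the
randomization `w` of the policy is independent of all the delays. -/
structure IsDelayModel {Ω : Type*} [MeasurableSpace Ω] (μ : Measure Ω) (θ : E → ℝ)
    (w : Ω → W) (d : Ω → ℕ → E → ℕ) : Prop where
  measurable_random : Measurable w
  measurable_delay : ∀ k i, Measurable fun ω => d ω k i
  geometric : ∀ k i (m : ℕ), μ {ω | d ω k i = m + 1} = ENNReal.ofReal (θ i * (1 - θ i) ^ m)
  iIndepFun_delay : iIndepFun (fun (ki : ℕ × E) (ω : Ω) => d ω ki.1 ki.2) μ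
  indepFun_random : IndepFun w d μ

end

end Routing

/-!
The first claim compares the constraints link by link. Pinsker's inequality
(`two_mul_sq_sub_le_kl`) turns an admissible `u` into a bound on `∑ t_i (u_i - x_i)₊²`, and
`1 / x - 1 / u ≤ (u - x)₊ / x²` together with the Cauchy-Schwarz inequality turns this into a bound
on `∑ 1 / x_i - ∑ 1 / u_i` (`pathDelay_sub_le_sqrt`).

For the second claim, `b_p > pᵀ θ⁻¹` means that `θ` itself is not admissible, so that the divergence
`∑ t_i KL(θ̂_i, θ_i)` exceeds `f₁(n)`; if some `θ_i < 1`, then `b_p ≥ pᵀ θ⁻¹` still forces this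
divergence to be at least `f₁(n)`, because otherwise `θ_i` could be increased a little
(`indexB_lt_pathDelay`). It remains to prove a concentration inequality for the divergence at the
fixed time `n` (`Policy.measure_le_sum_klBer_le`). Two facts carry it.

* For a fixed `u`, the likelihood ratio of `u` against `θ` along the packets sent so far is a product
  of factors with mean at most `1`, one for each packet and each link of its path. As each path is
  chosen before the delays on it are known, the mean of the product is at most `1`
  (`Policy.lintegral_weight_le_one`), whatever the policy.
* On one link, `t KL(s / t, θ)` is the logarithm of the likelihood ratio at `u = s / t`. A family of
  `O((log n)²)` values of `u`, whose divergences from the geometric law of parameter `θ` form a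
  geometric progression of ratio `1 + 1 / f₁(n)`, attains this maximum up to a factor `e` for all
  `s ≤ n` and all `t`, as far as values below `f₁(n)` are concerned
  (`exists_finset_exp_le_likelihoodRatio`). Working with the divergence per packet, not per attempt,
  matters: the number of packets is at most `n`, the number of attempts is unbounded.

Markov's inequality and a union bound over the product of these families, for the links of `p`, give
the probability `O((log n)²) ^ H * e ^ H * exp (-f₁(n)) = O(n⁻¹ (log n) ^ (-2 H))`. As `n` is
fixed, no maximal inequality is needed.
-/

namespace Routing


/-! ### The confidence level `f₁` -/

lemma f1_eq_coe (H : ℕ) {n : ℕ} (hn : 2 ≤ n) :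
    f1 H n = ((Real.log n + 4 * H * Real.log (Real.log n) : ℝ) : EReal) := by
  have hlog : 0 < Real.log n := Real.log_pos (by exact_mod_cast hn)
  rw [f1, ENNReal.log_ofReal_of_pos hlog]
  norm_cast

/-- `3 > e`, so that iterated logarithms are nonnegative from `3` on. -/
lemma one_le_log_natCast {n : ℕ} (hn : 3 ≤ n) : 1 ≤ Real.log n := by
  have h3 : (3 : ℝ) ≤ n := by exact_mod_cast hn
  rw [Real.le_log_iff_exp_le (by linarith)]
  linarith [Real.exp_one_lt_d9]

/-- At `n = 1` and `n = 2` the level is negative as soon as `H ≥ 1`, and no parameter is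
admissible in the definition of `indexB`. -/
lemma three_le_of_f1_nonneg {H n : ℕ} (hH : 1 ≤ H) (hn : 1 ≤ n) (h : 0 ≤ f1 H n) : 3 ≤ n := by
  have hH' : (1 : ℝ) ≤ H := by exact_mod_cast hH
  by_contra! hlt
  interval_cases n
  · have h4 : (0 : ℝ) < 4 * H := by linarith
    rw [f1, Nat.cast_one, Real.log_one, ENNReal.ofReal_zero, ENNReal.log_zero,
      EReal.coe_mul_bot_of_pos h4] at h
    simp at h
  · rw [f1_eq_coe H le_rfl] at h
    have h' : (0 : ℝ) ≤ Real.log (2 : ℕ) + 4 * H * Real.log (Real.log (2 : ℕ)) := by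
      exact_mod_cast h
    push_cast at h'
    have h1 := Real.log_two_gt_d9
    have h2 := Real.log_two_lt_d9
    have h3 : Real.log (Real.log 2) ≤ Real.log 2 - 1 := Real.log_le_sub_one_of_pos (by linarith)
    nlinarith

/-! ### Pinsker's inequality and the comparison of the two indexes -/

/-- Pinsker's inequality for two Bernoulli laws, above the first parameter. -/
lemma two_mul_sq_sub_le_kl {a b : ℝ} (ha : 0 < a) (hab : a ≤ b) (hb : b < 1) :
    2 * (b - a) ^ 2 ≤ a * Real.log (a / b) + (1 - a) * Real.log ((1 - a) / (1 - b)) := by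
  -- The difference of the two sides vanishes at `v = a`; its derivative in `v` is
  -- `(v - a) * (1 / (v * (1 - v)) - 4)`.
  let g : ℝ → ℝ := fun v =>
    a * (Real.log a - Real.log v) + (1 - a) * (Real.log (1 - a) - Real.log (1 - v))
      - 2 * (v - a) ^ 2
  have hder : ∀ v ∈ Set.Icc a b, HasDerivAt g
      (a * (0 - v⁻¹) + (1 - a) * (0 - (-1) / (1 - v)) - 2 * (2 * (v - a) ^ 1 * 1)) v := by
    intro v hv
    have hv0 : v ≠ 0 := by linarith [hv.1]
    have hv1 : 1 - v ≠ 0 := by linarith [hv.2]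
    have e1 := ((hasDerivAt_const v (Real.log a)).sub (Real.hasDerivAt_log hv0)).const_mul a
    have e2 := ((hasDerivAt_const v (Real.log (1 - a))).sub
      (((hasDerivAt_id v).const_sub 1).log hv1)).const_mul (1 - a)
    have e3 := (((hasDerivAt_id v).sub_const a).pow 2).const_mul 2
    exact (e1.add e2).sub e3
  have hmono : MonotoneOn g (Set.Icc a b) := by
    refine monotoneOn_of_hasDerivWithinAt_nonneg (convex_Icc a b)
      (fun v hv => (hder v hv).continuousAt.continuousWithinAt)
      (fun v hv => (hder v (interior_subset hv)).hasDerivWithinAt) fun v hv => ?_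
    have hv' := interior_subset hv
    have hv0 : 0 < v := by linarith [hv'.1]
    have hv1 : 0 < 1 - v := by linarith [hv'.2]
    have : a * (0 - v⁻¹) + (1 - a) * (0 - (-1) / (1 - v)) - 2 * (2 * (v - a) ^ 1 * 1)
        = (v - a) * (1 - 2 * v) ^ 2 / (v * (1 - v)) := by
      field_simp
      ring
    rw [this]
    have := sub_nonneg.2 hv'.1
    positivity
  have h := hmono (Set.left_mem_Icc.2 hab) (Set.right_mem_Icc.2 hab) hab
  have hg : 0 ≤ g b := by simpa [g] using h
  rw [Real.log_div ha.ne' (by linarith), Real.log_div (by linarith) (by linarith)]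
  simp only [g] at hg
  linarith

lemma ofReal_two_mul_sq_sub_le_klBer {a b : ℝ} (ha : 0 < a) (hab : a ≤ b) (hb : b ≤ 1) :
    ENNReal.ofReal (2 * (b - a) ^ 2) ≤ klBer a b := by
  unfold klBer
  split_ifs with h
  · exact le_top
  · rcases hb.lt_or_eq with hb | rfl
    · exact ENNReal.ofReal_le_ofReal (two_mul_sq_sub_le_kl ha hab hb)
    · have : a = 1 := by simpa using h
      simp [this]

/-- A real form of the comparison of the indexes: Pinsker's inequality on each link, and
Cauchy-Schwarz over the links. -/
lemma pathDelay_sub_le_sqrt {E : Type*} {p : Finset E} {t x u : E → ℝ} {F : ℝ}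
    (hx : ∀ i ∈ p, 0 < x i) (ht : ∀ i ∈ p, 0 < t i) (hu : ∀ i, 0 < u i ∧ u i ≤ 1) (hF : 0 ≤ F)
    (h : ∑ i ∈ p, ENNReal.ofReal (t i) * klBer (x i) (u i) ≤ ENNReal.ofReal F) :
    pathDelay p x - √(F / 2 * ∑ i ∈ p, (t i * x i * x i ^ 3)⁻¹) ≤ pathDelay p u := by
  set v : E → ℝ := fun i => max (u i - x i) 0 with hv
  have hsum : ∑ i ∈ p, t i * v i ^ 2 ≤ F / 2 := by
    have h1 : ENNReal.ofReal (∑ i ∈ p, t i * (2 * v i ^ 2)) ≤ ENNReal.ofReal F := by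
      rw [ENNReal.ofReal_sum_of_nonneg fun i hi => by have := ht i hi; positivity]
      refine le_trans (Finset.sum_le_sum fun i hi => ?_) h
      rw [ENNReal.ofReal_mul (ht i hi).le]
      gcongr
      rcases le_total (x i) (u i) with hxu | hxu
      · simpa [hv, max_eq_left (sub_nonneg.2 hxu)] using
          ofReal_two_mul_sq_sub_le_klBer (hx i hi) hxu (hu i).2
      · simp [hv, max_eq_right (sub_nonpos.2 hxu)]
    have h2 := (ENNReal.ofReal_le_ofReal_iff hF).1 h1
    have h3 : ∑ i ∈ p, t i * (2 * v i ^ 2) = 2 * ∑ i ∈ p, t i * v i ^ 2 := by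
      rw [Finset.mul_sum]
      exact Finset.sum_congr rfl fun i _ => by ring
    linarith
  have hstep : pathDelay p x - pathDelay p u ≤ ∑ i ∈ p, v i / x i ^ 2 := by
    rw [pathDelay, pathDelay, ← Finset.sum_sub_distrib]
    refine Finset.sum_le_sum fun i hi => ?_
    have hx0 := hx i hi
    have hu0 := (hu i).1
    rcases le_total (x i) (u i) with hxu | hxu
    · simp only [hv, max_eq_left (sub_nonneg.2 hxu)]
      have : (x i)⁻¹ - (u i)⁻¹ = (u i - x i) / (x i * u i) := by field_simp
      rw [this, pow_two]
      have := sub_nonneg.2 hxu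
      gcongr
    · have : 0 ≤ v i / x i ^ 2 := div_nonneg (le_max_right _ _) (by positivity)
      have := inv_anti₀ hu0 hxu
      linarith
  have hcs : (∑ i ∈ p, v i / x i ^ 2) ^ 2 ≤
      (∑ i ∈ p, t i * v i ^ 2) * ∑ i ∈ p, (t i * x i * x i ^ 3)⁻¹ := by
    refine Finset.sum_sq_le_sum_mul_sum_of_sq_le_mul p (fun i hi => ?_) (fun i hi => ?_)
      fun i hi => le_of_eq ?_
    · have := ht i hi; positivity
    · have := ht i hi; have := hx i hi; positivity
    · have := (ht i hi).ne'; have := (hx i hi).ne'; field_simp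
  have hnn : 0 ≤ ∑ i ∈ p, (t i * x i * x i ^ 3)⁻¹ :=
    Finset.sum_nonneg fun i hi => by have := ht i hi; have := hx i hi; positivity
  have := Real.le_sqrt_of_sq_le (hcs.trans (mul_le_mul_of_nonneg_right hsum hnn))
  linarith

lemma indexC_le_indexB {E : Type*} {H n : ℕ} {p : Finset E} {s t x : E → ℝ} (hn : 1 ≤ n)
    (hp : p.card ≤ H) (hx : ∀ i ∈ p, 0 < x i ∧ x i ≤ 1)
    (hst : ∀ i ∈ p, 0 ≤ t i ∧ s i = t i * x i) :
    indexC H p n s x ≤ indexB H p n t x := by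
  refine le_sInf ?_
  rintro _ ⟨u, hu, hfeas, rfl⟩
  rcases p.eq_empty_or_nonempty with rfl | hne
  · simp [indexC, pathDelay]
  have hf0 : 0 ≤ f1 H n := le_trans (by positivity) hfeas
  have hH : 1 ≤ H := hne.card_pos.trans_le hp
  have hn3 := three_le_of_f1_nonneg hH hn hf0
  set F : ℝ := Real.log n + 4 * H * Real.log (Real.log n) with hFdef
  have hf : f1 H n = (F : EReal) := f1_eq_coe H (by omega)
  have hF : 0 < F := by
    have h1 := one_le_log_natCast hn3
    have h2 := Real.log_nonneg h1
    have : 0 ≤ 4 * (H : ℝ) * Real.log (Real.log n) := by positivity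
    linarith
  rw [indexC, hf, EReal.real_coe_toENNReal]
  by_cases ht : ∀ i ∈ p, 0 < t i
  · have hfeas' : ∑ i ∈ p, ENNReal.ofReal (t i) * klBer (x i) (u i) ≤ ENNReal.ofReal F := by
      rw [hf] at hfeas
      rw [← EReal.coe_ennreal_le_coe_ennreal_iff, EReal.coe_ennreal_ofReal, max_eq_left hF.le]
      exact hfeas
    have hreal := pathDelay_sub_le_sqrt (fun i hi => (hx i hi).1) ht hu hF.le hfeas'
    have hterm : ∀ i ∈ p, 0 < t i * x i * x i ^ 3 := fun i hi => by
      have := ht i hi; have := (hx i hi).1; positivity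
    have hroot : ((ENNReal.ofReal F / 2 * ∑ i ∈ p, (ENNReal.ofReal (s i * x i ^ 3))⁻¹) ^
        (1 / 2 : ℝ) : ℝ≥0∞) =
        ENNReal.ofReal √(F / 2 * ∑ i ∈ p, (t i * x i * x i ^ 3)⁻¹) := by
      have hsum : ∑ i ∈ p, (ENNReal.ofReal (s i * x i ^ 3))⁻¹ =
          ENNReal.ofReal (∑ i ∈ p, (t i * x i * x i ^ 3)⁻¹) := by
        rw [ENNReal.ofReal_sum_of_nonneg fun i hi => inv_nonneg.2 (hterm i hi).le]
        refine Finset.sum_congr rfl fun i hi => ?_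
        rw [(hst i hi).2, ENNReal.ofReal_inv_of_pos (hterm i hi)]
      have h2 : ENNReal.ofReal F / 2 = ENNReal.ofReal (F / 2) := by
        rw [ENNReal.ofReal_div_of_pos two_pos, ENNReal.ofReal_ofNat]
      have hnn : 0 ≤ ∑ i ∈ p, (t i * x i * x i ^ 3)⁻¹ :=
        Finset.sum_nonneg fun i hi => inv_nonneg.2 (hterm i hi).le
      rw [hsum, h2, ← ENNReal.ofReal_mul (by positivity), Real.sqrt_eq_rpow,
        ENNReal.ofReal_rpow_of_nonneg (by positivity) (by norm_num)]
    rw [hroot, EReal.coe_ennreal_ofReal, max_eq_left (Real.sqrt_nonneg _)]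
    exact_mod_cast hreal
  · -- An unused link makes the confidence term infinite.
    push Not at ht
    obtain ⟨i, hi, hti⟩ := ht
    have hsi : s i = 0 := by
      rw [(hst i hi).2, le_antisymm hti (hst i hi).1, zero_mul]
    have htop : ∑ i ∈ p, (ENNReal.ofReal (s i * x i ^ 3))⁻¹ = ⊤ :=
      ENNReal.sum_eq_top.2 ⟨i, hi, by simp [hsi]⟩
    have hF2 : ENNReal.ofReal F / 2 ≠ 0 := by simp [hF]
    rw [htop, ENNReal.mul_top hF2, ENNReal.top_rpow_of_pos (by norm_num)]
    simp


/-! ### Finite families of alternative parameters for one link -/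

/-- The Kullback-Leibler divergence between the geometric laws with success probabilities `u` and
`θ`, that is `KL(u, θ) / u`: the divergence per packet instead of per attempt. It is written so as
to be continuous at `u = 1`. -/
noncomputable def klGeom (θ u : ℝ) : ℝ :=
  Real.log u - Real.log θ + u⁻¹ * ((1 - u) * Real.log (1 - u) - (1 - u) * Real.log (1 - θ))

/-- The likelihood ratio between the parameters `u` and `θ` of a link, after `s` packets and `t`
attempts. -/
noncomputable def likelihoodRatio (θ u : ℝ) (s t : ℕ) : ℝ :=
  (u / θ) ^ s * ((1 - u) / (1 - θ)) ^ (t - s)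

/-- The finite value `t KL(s / t, θ)` of the contribution of a link to the divergence, after `s`
packets and `t` attempts. -/
noncomputable def attemptsKL (θ : ℝ) (s t : ℕ) : ℝ :=
  t * ((s / t : ℝ) * Real.log ((s / t : ℝ) / θ) +
    (1 - (s / t : ℝ)) * Real.log ((1 - (s / t : ℝ)) / (1 - θ)))

lemma klGeom_self (θ : ℝ) : klGeom θ θ = 0 := by simp [klGeom]

lemma continuousOn_klGeom (θ : ℝ) : ContinuousOn (klGeom θ) (Set.Ioi 0) := by
  unfold klGeom
  have h1 : ContinuousOn Real.log (Set.Ioi 0) :=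
    Real.continuousOn_log.mono fun u hu => (Set.mem_Ioi.1 hu).ne'
  have h2 : Continuous fun u : ℝ => (1 - u) * Real.log (1 - u) :=
    Real.continuous_mul_log.comp (continuous_const.sub continuous_id)
  have h3 : ContinuousOn (fun u : ℝ => u⁻¹) (Set.Ioi 0) :=
    continuousOn_inv₀.mono fun u hu => (Set.mem_Ioi.1 hu).ne'
  fun_prop

lemma hasDerivAt_klGeom {θ u : ℝ} (hu0 : 0 < u) (hu1 : u < 1) :
    HasDerivAt (klGeom θ) ((u ^ 2)⁻¹ * (Real.log (1 - θ) - Real.log (1 - u))) u := by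
  have h1u : 1 - u ≠ 0 := by linarith
  have e0 := (hasDerivAt_id u).const_sub 1
  have e1 := (Real.hasDerivAt_log hu0.ne').sub_const (Real.log θ)
  have e2 := (e0.mul (e0.log h1u)).sub (e0.mul_const (Real.log (1 - θ)))
  refine (e1.add ((hasDerivAt_inv hu0.ne').mul e2)).congr_deriv ?_
  simp only [id, Pi.mul_apply, Pi.sub_apply]
  field_simp
  ring

lemma antitoneOn_klGeom {θ : ℝ} (hθ : θ < 1) : AntitoneOn (klGeom θ) (Set.Ioc 0 θ) := by
  refine antitoneOn_of_hasDerivWithinAt_nonpos (convex_Ioc 0 θ)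
    ((continuousOn_klGeom θ).mono fun u hu => hu.1)
    (fun u hu => (hasDerivAt_klGeom (interior_subset hu).1
      ((interior_subset hu).2.trans_lt hθ)).hasDerivWithinAt) fun u hu => ?_
  have hu' := interior_subset hu
  have := Real.log_le_log (by linarith) (by linarith [hu'.2] : 1 - θ ≤ 1 - u)
  exact mul_nonpos_of_nonneg_of_nonpos (by positivity) (by linarith)

lemma monotoneOn_klGeom {θ : ℝ} (hθ : 0 < θ) : MonotoneOn (klGeom θ) (Set.Icc θ 1) := by
  refine monotoneOn_of_hasDerivWithinAt_nonneg (f' := fun u =>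
      (u ^ 2)⁻¹ * (Real.log (1 - θ) - Real.log (1 - u))) (convex_Icc θ 1)
    ((continuousOn_klGeom θ).mono fun u hu => hθ.trans_le hu.1) (fun u hu => ?_) fun u hu => ?_
  all_goals rw [interior_Icc] at hu
  · exact (hasDerivAt_klGeom (hθ.trans hu.1) hu.2).hasDerivWithinAt
  · have := Real.log_le_log (by linarith [hu.2]) (by linarith [hu.1] : 1 - u ≤ 1 - θ)
    exact mul_nonneg (by positivity) (by linarith)

lemma attemptsKL_eq_mul_klGeom {θ : ℝ} (hθ0 : 0 < θ) (hθ1 : θ < 1) {s t : ℕ} (hs : 0 < s)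
    (hst : s ≤ t) : attemptsKL θ s t = s * klGeom θ (s / t) := by
  have hs' : (0 : ℝ) < s := by exact_mod_cast hs
  have ht' : (0 : ℝ) < t := by exact_mod_cast hs.trans_le hst
  have hlog : (1 - (s / t : ℝ)) * Real.log ((1 - (s / t : ℝ)) / (1 - θ)) =
      (1 - (s / t : ℝ)) * Real.log (1 - (s / t : ℝ)) -
        (1 - (s / t : ℝ)) * Real.log (1 - θ) := by
    rcases eq_or_ne (1 - (s / t : ℝ)) 0 with h | h
    · simp [h]
    · rw [Real.log_div h (by linarith)]
      ring
  rw [attemptsKL, klGeom, hlog, Real.log_div (by positivity) hθ0.ne']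
  field_simp

/-- If `u` lies between `θ` and the empirical parameter `s / t`, then the likelihood ratio of `u`
is at least as large as if `u` were itself the empirical parameter. -/
lemma exp_mul_klGeom_le_likelihoodRatio {θ u : ℝ} (hθ0 : 0 < θ) (hθ1 : θ < 1) (hu0 : 0 < u)
    (hu1 : u ≤ 1) {s t : ℕ} (hs : 0 < s) (hst : s ≤ t)
    (h : ((s / t : ℝ) ≤ u ∧ u ≤ θ) ∨ (θ ≤ u ∧ u ≤ (s / t : ℝ))) :
    Real.exp (s * klGeom θ u) ≤ likelihoodRatio θ u s t := by
  have hs' : (0 : ℝ) < s := by exact_mod_cast hs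
  have ht' : (0 : ℝ) < t := by exact_mod_cast hs.trans_le hst
  rcases hu1.lt_or_eq with hu1 | rfl
  · have hrhs : likelihoodRatio θ u s t = Real.exp (s * (Real.log u - Real.log θ) +
        (t - s) * (Real.log (1 - u) - Real.log (1 - θ))) := by
      rw [likelihoodRatio, ← Real.log_div hu0.ne' hθ0.ne',
        ← Real.log_div (by linarith) (by linarith), Real.exp_add, ← Nat.cast_sub hst,
        Real.exp_nat_mul, Real.exp_nat_mul, Real.exp_log (by positivity),
        Real.exp_log (div_pos (by linarith) (by linarith))]
    rw [hrhs]
    refine Real.exp_le_exp.2 ?_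
    have hk : s * klGeom θ u = s * (Real.log u - Real.log θ) +
        (s / u - s) * (Real.log (1 - u) - Real.log (1 - θ)) := by
      rw [klGeom]
      field_simp
    rw [hk]
    refine add_le_add_right ?_ _
    rcases h with ⟨h1, h2⟩ | ⟨h1, h2⟩
    · have h3 := Real.log_le_log (by linarith) (by linarith : 1 - θ ≤ 1 - u)
      have h4 : (s : ℝ) / u ≤ t := by
        rw [div_le_iff₀ ht'] at h1
        rw [div_le_iff₀ hu0]
        linarith
      exact mul_le_mul_of_nonneg_right (by linarith) (by linarith)
    · have h3 := Real.log_le_log (by linarith) (by linarith : 1 - u ≤ 1 - θ)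
      have h4 : (t : ℝ) ≤ s / u := by
        rw [le_div_iff₀ ht'] at h2
        rw [le_div_iff₀ hu0]
        linarith
      exact mul_le_mul_of_nonpos_right (by linarith) (by linarith)
  · -- For `u = 1` the empirical parameter is `1` as well: every attempt was successful.
    have hts : t = s := by
      rcases h with ⟨-, h2⟩ | ⟨-, h2⟩
      · linarith
      · rw [one_le_div ht'] at h2
        exact le_antisymm (by exact_mod_cast h2) hst
    subst hts
    simp [likelihoodRatio, klGeom, ← Real.log_inv, Real.exp_nat_mul, Real.exp_log (inv_pos.2 hθ0)]

/-- On each side of `θ`, one parameter with a given divergence serves for all the empirical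
parameters that are farther away from `θ`. -/
lemma exists_forall_exp_mul_le_likelihoodRatio {θ : ℝ} (hθ0 : 0 < θ) (hθ1 : θ < 1) (z : ℝ)
    (hz : 0 ≤ z) :
    ∃ u₁ u₂ : ℝ, (0 < u₁ ∧ u₁ ≤ 1) ∧ (0 < u₂ ∧ u₂ ≤ 1) ∧ ∀ s t : ℕ, 0 < s → s ≤ t →
      z < klGeom θ (s / t) → Real.exp (s * z) ≤ likelihoodRatio θ u₁ s t ∨
        Real.exp (s * z) ≤ likelihoodRatio θ u₂ s t := by
  have hlow : ∃ u₁ : ℝ, (0 < u₁ ∧ u₁ ≤ θ) ∧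
      ∀ a, 0 < a → a ≤ θ → z < klGeom θ a → klGeom θ u₁ = z ∧ a ≤ u₁ := by
    by_cases h : ∃ a, 0 < a ∧ a ≤ θ ∧ z < klGeom θ a
    · obtain ⟨a, ha0, haθ, ha⟩ := h
      obtain ⟨u, hu, huz⟩ := intermediate_value_Icc' haθ
        ((continuousOn_klGeom θ).mono fun v hv => ha0.trans_le hv.1)
        ⟨by rwa [klGeom_self], ha.le⟩
      have hu0 : 0 < u := ha0.trans_le hu.1
      refine ⟨u, ⟨hu0, hu.2⟩, fun b hb0 hbθ hb => ⟨huz, ?_⟩⟩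
      by_contra! hlt
      have := antitoneOn_klGeom hθ1 ⟨hu0, hu.2⟩ ⟨hb0, hbθ⟩ hlt.le
      linarith
    · push Not at h
      exact ⟨θ, ⟨hθ0, le_rfl⟩, fun a h1 h2 h3 => absurd h3 (h a h1 h2).not_gt⟩
  have hupp : ∃ u₂ : ℝ, (θ ≤ u₂ ∧ u₂ ≤ 1) ∧
      ∀ a, θ ≤ a → a ≤ 1 → z < klGeom θ a → klGeom θ u₂ = z ∧ u₂ ≤ a := by
    by_cases h : ∃ a, θ ≤ a ∧ a ≤ 1 ∧ z < klGeom θ a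
    · obtain ⟨a, haθ, ha1, ha⟩ := h
      obtain ⟨u, hu, huz⟩ := intermediate_value_Icc haθ
        ((continuousOn_klGeom θ).mono fun v hv => hθ0.trans_le hv.1)
        ⟨by rwa [klGeom_self], ha.le⟩
      have hu1 : u ≤ 1 := hu.2.trans ha1
      refine ⟨u, ⟨hu.1, hu1⟩, fun b hbθ hb1 hb => ⟨huz, ?_⟩⟩
      by_contra! hlt
      have := monotoneOn_klGeom hθ0 ⟨hbθ, hb1⟩ ⟨hu.1, hu1⟩ hlt.le
      linarith
    · push Not at h
      exact ⟨θ, ⟨le_rfl, hθ1.le⟩, fun a h1 h2 h3 => absurd h3 (h a h1 h2).not_gt⟩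
  obtain ⟨u₁, hu₁, h₁⟩ := hlow
  obtain ⟨u₂, hu₂, h₂⟩ := hupp
  refine ⟨u₁, u₂, ⟨hu₁.1, hu₁.2.trans hθ1.le⟩, ⟨hθ0.trans_le hu₂.1, hu₂.2⟩, fun s t hs hst hz => ?_⟩
  have hs' : (0 : ℝ) < s := by exact_mod_cast hs
  have ht' : (0 : ℝ) < t := by exact_mod_cast hs.trans_le hst
  have hst' : (s : ℝ) ≤ t := by exact_mod_cast hst
  rcases le_total (s / t : ℝ) θ with h | h
  · obtain ⟨rfl, h4⟩ := h₁ _ (by positivity) h hz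
    exact .inl (exp_mul_klGeom_le_likelihoodRatio hθ0 hθ1 hu₁.1 (hu₁.2.trans hθ1.le) hs hst
      (.inl ⟨h4, hu₁.2⟩))
  · obtain ⟨rfl, h4⟩ := h₂ _ h (div_le_one_of_le₀ hst' ht'.le) hz
    exact .inr (exp_mul_klGeom_le_likelihoodRatio hθ0 hθ1 (hθ0.trans_le hu₂.1) hu₂.2 hs hst
      (.inr ⟨hu₂.1, h4⟩))

/-- A family of about `2 δ log (δ N)` parameters, one of which has, up to a factor `e`, the
likelihood ratio `exp (t KL(s / t, θ))` of the empirical parameter (truncated at `exp δ`),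
whatever the numbers `s ≤ N` of packets and `t` of attempts. -/
lemma exists_finset_exp_le_likelihoodRatio {θ δ : ℝ} {N : ℕ} (hθ0 : 0 < θ) (hθ1 : θ ≤ 1)
    (hδ : 1 ≤ δ) (hN : 1 ≤ N) :
    ∃ D : Finset ℝ, (D.card : ℝ) ≤ 2 * ((δ + 1) * Real.log (δ * N)) + 3 ∧
      (∀ u ∈ D, 0 < u ∧ u ≤ 1) ∧
      ∀ s t : ℕ, s ≤ N → s ≤ t → (s = 0 → t = 0) → (θ = 1 → t = s) →
        ∃ u ∈ D, Real.exp (min δ (attemptsKL θ s t) - 1) ≤ likelihoodRatio θ u s t := by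
  classical
  have hδ0 : 0 < δ := by linarith
  have hN' : (1 : ℝ) ≤ N := by exact_mod_cast hN
  have hlogN : 0 ≤ Real.log (δ * N) := Real.log_nonneg (by nlinarith)
  -- If the truncated divergence is at most `1`, then `u = θ` will do.
  have hself : ∀ s t : ℕ, (θ = 1 → t = s) → min δ (attemptsKL θ s t) ≤ 1 →
      Real.exp (min δ (attemptsKL θ s t) - 1) ≤ likelihoodRatio θ θ s t := by
    intro s t hts hle
    have hlr : likelihoodRatio θ θ s t = 1 := by
      rcases hθ1.lt_or_eq with h | h
      · rw [likelihoodRatio, div_self hθ0.ne', div_self (by linarith)]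
        simp
      · simp [likelihoodRatio, hts h, h]
    rw [hlr]
    exact Real.exp_le_one_iff.2 (by linarith)
  rcases hθ1.eq_or_lt with rfl | hθ1
  · refine ⟨{1}, ?_, by simp, fun s t _ _ _ hts => ⟨1, by simp, hself s t hts ?_⟩⟩
    · have : 0 ≤ (δ + 1) * Real.log (δ * N) := by positivity
      simp only [Finset.card_singleton, Nat.cast_one]
      linarith
    · refine (min_le_right _ _).trans ?_
      rw [hts rfl, attemptsKL]
      rcases eq_or_ne (s : ℝ) 0 with h | h
      · simp [h]
      · simp [div_self h]
  -- The divergences per packet of the family are `δ / r ^ (j + 1)`.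
  set r : ℝ := 1 + δ⁻¹ with hr
  have hr1 : 1 < r := by simp [hr, hδ0]
  have hr0 : 0 < r := by linarith
  have hδr : δ * r = δ + 1 := by rw [hr]; field_simp
  choose u₁ u₂ hu₁ hu₂ hu using fun j : ℕ =>
    exists_forall_exp_mul_le_likelihoodRatio hθ0 hθ1 (δ / r ^ (j + 1)) (by positivity)
  set J : ℕ := ⌊(δ + 1) * Real.log (δ * N)⌋₊ + 1 with hJ
  refine ⟨insert θ ((Finset.range J).image u₁ ∪ (Finset.range J).image u₂), ?_, ?_, ?_⟩
  · have hcard : (insert θ ((Finset.range J).image u₁ ∪ (Finset.range J).image u₂)).card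
        ≤ J + J + 1 := by
      refine (Finset.card_insert_le _ _).trans (Nat.succ_le_succ ?_)
      refine (Finset.card_union_le _ _).trans ?_
      exact add_le_add (Finset.card_image_le.trans_eq (Finset.card_range J))
        (Finset.card_image_le.trans_eq (Finset.card_range J))
    have h1 : (J : ℝ) ≤ (δ + 1) * Real.log (δ * N) + 1 := by
      rw [hJ, Nat.cast_add_one]
      gcongr
      exact Nat.floor_le (by positivity)
    have h2 : ((insert θ ((Finset.range J).image u₁ ∪ (Finset.range J).image u₂)).card : ℝ)
        ≤ J + J + 1 := by exact_mod_cast hcard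
    linarith
  · intro u hmem
    simp only [Finset.mem_insert, Finset.mem_union, Finset.mem_image] at hmem
    rcases hmem with rfl | ⟨j, -, rfl⟩ | ⟨j, -, rfl⟩
    exacts [⟨hθ0, hθ1.le⟩, hu₁ j, hu₂ j]
  · intro s t hsN hst hs0 hts
    set x := min δ (attemptsKL θ s t) with hx
    rcases le_or_gt x 1 with hx1 | hx1
    · exact ⟨θ, by simp, hself s t hts hx1⟩
    have hs : 0 < s := by
      by_contra! h
      have h0 : s = 0 := by omega
      have : attemptsKL θ s t = 0 := by simp [attemptsKL, hs0 h0]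
      have := min_le_right δ (attemptsKL θ s t)
      linarith
    have hs1 : (1 : ℝ) ≤ s := by exact_mod_cast hs
    have hs' : (0 : ℝ) < s := by linarith
    have hsN' : (s : ℝ) ≤ N := by exact_mod_cast hsN
    have hxδ : x ≤ δ := min_le_left _ _
    have hxk : x ≤ s * klGeom θ (s / t) :=
      (min_le_right _ _).trans_eq (attemptsKL_eq_mul_klGeom hθ0 hθ1 hs hst)
    have hx0 : 0 < x := by linarith
    obtain ⟨j, hj1, hj2⟩ := exists_nat_pow_near (x := δ * s / x) (y := r)
      (by rw [one_le_div hx0]; nlinarith) hr1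
    have hjJ : j < J := by
      have h1 : r ^ j ≤ δ * N := by
        refine hj1.trans ?_
        rw [div_le_iff₀ hx0]
        have : δ * s ≤ δ * N := by gcongr
        exact this.trans (le_mul_of_one_le_right (by positivity) hx1.le)
      have h2 : j * Real.log r ≤ Real.log (δ * N) := by
        rw [← Real.log_pow]
        exact Real.log_le_log (by positivity) h1
      have h3 : 1 ≤ (δ + 1) * Real.log r := by
        have h4 := Real.one_sub_inv_le_log_of_pos hr0
        have h5 : (δ + 1) * (1 - r⁻¹) = 1 := by
          rw [← hδr, mul_assoc, mul_sub, mul_one, mul_inv_cancel₀ hr0.ne', mul_sub, hδr]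
          ring
        calc (1 : ℝ) = (δ + 1) * (1 - r⁻¹) := h5.symm
          _ ≤ _ := by gcongr
      have h6 : (j : ℝ) ≤ (δ + 1) * Real.log (δ * N) := by
        calc (j : ℝ) = j * 1 := (mul_one _).symm
          _ ≤ j * ((δ + 1) * Real.log r) := by gcongr
          _ = (δ + 1) * (j * Real.log r) := by ring
          _ ≤ _ := by gcongr
      rw [hJ]
      exact Nat.lt_succ_of_le (Nat.le_floor h6)
    have hz : δ / r ^ (j + 1) < klGeom θ (s / t) := by
      rw [div_lt_iff₀ hx0] at hj2
      rw [div_lt_iff₀ (by positivity)]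
      by_contra! hle
      have h1 : s * (klGeom θ (s / t) * r ^ (j + 1)) ≤ s * δ := by gcongr
      have h2 : x * r ^ (j + 1) ≤ s * klGeom θ (s / t) * r ^ (j + 1) := by gcongr
      nlinarith
    have hsz : x - 1 ≤ s * (δ / r ^ (j + 1)) := by
      rw [le_div_iff₀ hx0] at hj1
      have h1 : x / r ≤ s * (δ / r ^ (j + 1)) := by
        rw [div_le_iff₀ hr0, pow_succ]
        have : s * (δ / (r ^ j * r)) * r = s * δ / r ^ j := by field_simp
        rw [this, le_div_iff₀ (by positivity)]
        linarith
      have h2 : x - 1 ≤ x / r := by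
        rw [le_div_iff₀ hr0, hr]
        have : x * δ⁻¹ ≤ 1 := by rwa [← div_eq_mul_inv, div_le_one hδ0]
        have : 0 < δ⁻¹ := by positivity
        nlinarith
      linarith
    have hexp : Real.exp (x - 1) ≤ Real.exp (s * (δ / r ^ (j + 1))) := Real.exp_le_exp.2 hsz
    rcases hu j s t hs hst hz with h | h
    · exact ⟨u₁ j, by simp only [Finset.mem_insert, Finset.mem_union, Finset.mem_image,
        Finset.mem_range]; exact .inr (.inl ⟨j, hjJ, rfl⟩), hexp.trans h⟩
    · exact ⟨u₂ j, by simp only [Finset.mem_insert, Finset.mem_union, Finset.mem_image,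
        Finset.mem_range]; exact .inr (.inr ⟨j, hjJ, rfl⟩), hexp.trans h⟩


/-! ### Products along an adaptive sequence of paths -/

section Model

variable {V E : Type*} [Fintype E] [DecidableEq E] {G : Network V E}
  {W : Type*} [MeasurableSpace W]

/-- The countable set of histories is given the discrete `σ`-algebra. -/
instance : MeasurableSpace (List (Record E)) := ⊤

instance : DiscreteMeasurableSpace (List (Record E)) := ⟨fun _ => trivial⟩

lemma Policy.measurable_choose_history (π : Policy G W) {m : ℕ}
    (h : Measurable fun x : W × (ℕ → E → ℕ) => π.history x.1 x.2 m) :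
    Measurable fun x : W × (ℕ → E → ℕ) => π.choose x.1 (π.history x.1 x.2 m) := by
  have hchoose : Measurable fun z : W × List (Record E) => π.choose z.1 z.2 :=
    measurable_from_prod_countable_left fun l =>
      measurable_to_countable' fun q => π.measurableSet_choose l q
  exact hchoose.comp (measurable_fst.prodMk h)

lemma Policy.measurable_history (π : Policy G W) (m : ℕ) :
    Measurable fun x : W × (ℕ → E → ℕ) => π.history x.1 x.2 m := by
  induction m with
  | zero => exact measurable_const
  | succ m ih =>
    have hd : Measurable fun x : W × (ℕ → E → ℕ) => x.2 (m + 1) :=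
      (measurable_pi_apply (m + 1)).comp measurable_snd
    have happend : Measurable fun z : List (Record E) × Finset E × (E → ℕ) =>
        z.1 ++ [((z.2.1, fun i => if i ∈ z.2.1 then z.2.2 i else 0) : Record E)] :=
      Measurable.of_discrete
    exact happend.comp (ih.prodMk ((π.measurable_choose_history ih).prodMk hd))

lemma Policy.measurable_path (π : Policy G W) (n : ℕ) :
    Measurable fun x : W × (ℕ → E → ℕ) => π.path x.1 x.2 n :=
  π.measurable_choose_history (π.measurable_history (n - 1))

/-- The first `m` records depend only on the delays of the first `m` packets. -/
lemma Policy.history_congr (π : Policy G W) (w : W) {d d' : ℕ → E → ℕ} {m : ℕ}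
    (h : ∀ k ≤ m, d k = d' k) : π.history w d m = π.history w d' m := by
  induction m with
  | zero => rfl
  | succ m ih =>
    simp only [Policy.history, ih fun k hk => h k (hk.trans m.le_succ), h (m + 1) le_rfl]

lemma Policy.path_congr (π : Policy G W) (w : W) {d d' : ℕ → E → ℕ} {n : ℕ}
    (h : ∀ k < n, d k = d' k) : π.path w d n = π.path w d' n := by
  rcases n with _ | n
  · rfl
  · simp only [Policy.path, Nat.add_sub_cancel]
    rw [π.history_congr w fun k hk => h k (Nat.lt_succ_of_le hk)]

/-- The product of the weights `g i (d k i)` over the packets `k < n` and the links `i` of their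
paths. -/
noncomputable def Policy.weight (π : Policy G W) (g : E → ℕ → ℝ≥0∞) (w : W) (d : ℕ → E → ℕ)
    (n : ℕ) : ℝ≥0∞ :=
  ∏ k ∈ Finset.Ico 1 n, ∏ i ∈ π.path w d k, g i (d k i)

lemma Policy.measurable_weight (π : Policy G W) (g : E → ℕ → ℝ≥0∞) (n : ℕ) :
    Measurable fun x : W × (ℕ → E → ℕ) => π.weight g x.1 x.2 n := by
  refine Finset.measurable_fun_prod _ fun k _ => ?_
  have hprod : Measurable fun z : Finset E × (E → ℕ) => ∏ i ∈ z.1, g i (z.2 i) :=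
    Measurable.of_discrete
  exact hprod.comp
    ((π.measurable_path k).prodMk ((measurable_pi_apply k).comp measurable_snd))

lemma Policy.weight_congr (π : Policy G W) (g : E → ℕ → ℝ≥0∞) (w : W) {d d' : ℕ → E → ℕ} {n : ℕ}
    (h : ∀ k < n, d k = d' k) : π.weight g w d n = π.weight g w d' n := by
  refine Finset.prod_congr rfl fun k hk => ?_
  have hkn := (Finset.mem_Ico.1 hk).2
  rw [π.path_congr w fun j hj => h j (hj.trans hkn), h k hkn]

variable {Ω : Type*} [MeasurableSpace Ω] {μ : Measure Ω} {d : Ω → ℕ → E → ℕ}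

/-- A function of the delays of the packets before `n` is independent of the delays of packet
`n`. -/
lemma indepFun_of_forall_lt (hmeas : ∀ k i, Measurable fun ω => d ω k i)
    (hind : iIndepFun (fun (ki : ℕ × E) (ω : Ω) => d ω ki.1 ki.2) μ) {n : ℕ}
    {f : (ℕ → E → ℕ) → ℝ≥0∞} (hf : Measurable f)
    (hfn : ∀ d d', (∀ k < n, d k = d' k) → f d = f d')
    {g : (E → ℕ) → ℝ≥0∞} (hg : Measurable g) :
    IndepFun (fun ω => f (d ω)) (fun ω => g (d ω n)) μ := by
  set S : Finset (ℕ × E) := Finset.range n ×ˢ Finset.univ with hS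
  set T : Finset (ℕ × E) := {n} ×ˢ Finset.univ with hT
  have hdisj : Disjoint S T := by
    rw [Finset.disjoint_left]
    rintro ⟨k, i⟩ h1 h2
    simp only [hS, hT, Finset.mem_product, Finset.mem_range, Finset.mem_singleton] at h1 h2
    omega
  have hST := hind.indepFun_finset S T hdisj fun ki => hmeas ki.1 ki.2
  let ext : (S → ℕ) → ℕ → E → ℕ := fun v k i => if h : (k, i) ∈ S then v ⟨(k, i), h⟩ else 0
  have hext : Measurable ext := by
    refine measurable_pi_lambda _ fun k => measurable_pi_lambda _ fun i => ?_
    by_cases h : (k, i) ∈ S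
    · simpa only [ext, h, dite_true] using measurable_pi_apply _
    · simpa only [ext, h, dite_false] using measurable_const
  let row : (T → ℕ) → E → ℕ := fun v i => v ⟨(n, i), by simp [hT]⟩
  have hrow : Measurable row := measurable_pi_lambda _ fun i => measurable_pi_apply _
  have hfe : (fun ω => f (d ω)) =
      (f ∘ ext) ∘ fun ω (ki : S) => d ω (ki : ℕ × E).1 (ki : ℕ × E).2 := by
    funext ω
    refine hfn _ _ fun k hk => funext fun i => ?_
    have h : (k, i) ∈ S := by simp [hS, hk]
    simp only [ext, h, dite_true]
  rw [hfe]
  exact hST.comp (hf.comp hext) (hg.comp hrow)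

/-- If all the weights have mean at most `1`, then so does their product along the paths, for a
fixed value of the randomization: conditionally on the past, the next path is a constant. -/
lemma Policy.lintegral_weight_le_one_of_fixed (π : Policy G W) (g : E → ℕ → ℝ≥0∞)
    (hmeas : ∀ k i, Measurable fun ω => d ω k i)
    (hind : iIndepFun (fun (ki : ℕ × E) (ω : Ω) => d ω ki.1 ki.2) μ)
    (hg : ∀ k i, ∫⁻ ω, g i (d ω k i) ∂μ ≤ 1) (w : W) (n : ℕ) :
    ∫⁻ ω, π.weight g w (d ω) n ∂μ ≤ 1 := by
  have : IsProbabilityMeasure μ := hind.isProbabilityMeasure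
  have hd : Measurable d :=
    measurable_pi_lambda _ fun k => measurable_pi_lambda _ fun i => hmeas k i
  induction n with
  | zero => simp [Policy.weight]
  | succ n ih =>
    rcases Nat.eq_zero_or_pos n with rfl | hn
    · simp [Policy.weight]
    -- `A q` is the product over the past, restricted to the event that the next path is `q`.
    let A : Finset E → (ℕ → E → ℕ) → ℝ≥0∞ := fun q d =>
      π.weight g w d n * if π.path w d n = q then 1 else 0
    let B : Finset E → (E → ℕ) → ℝ≥0∞ := fun q v => ∏ i ∈ q, g i (v i)
    have hsplit : ∀ d, π.weight g w d (n + 1) = ∑ q, A q d * B q (d n) := by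
      intro d
      simp only [A, B, mul_assoc]
      rw [← Finset.mul_sum]
      simp only [ite_mul, one_mul, zero_mul, Finset.sum_ite_eq, Finset.mem_univ, if_true]
      rw [Policy.weight, Finset.prod_Ico_succ_top (by omega)]
      rfl
    have hsum : ∀ d, π.weight g w d n = ∑ q, A q d := by
      intro d
      simp only [A]
      rw [← Finset.mul_sum]
      simp
    have hpair : Measurable fun d : ℕ → E → ℕ => (w, d) := measurable_const.prodMk measurable_id
    have hpath : Measurable fun d : ℕ → E → ℕ => π.path w d n :=
      (π.measurable_path n).comp hpair
    have hA : ∀ q, Measurable (A q) := fun q =>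
      ((π.measurable_weight g n).comp hpair).mul
        ((measurable_of_countable fun q' : Finset E => if q' = q then (1 : ℝ≥0∞) else 0).comp hpath)
    have hAn : ∀ q d d', (∀ k < n, d k = d' k) → A q d = A q d' := fun q d d' h => by
      simp only [A, π.weight_congr g w h, π.path_congr w h]
    have hB : ∀ q, Measurable (B q) := fun q => measurable_of_countable _
    have hdn : Measurable fun ω => d ω n := (measurable_pi_apply n).comp hd
    have hBle : ∀ q, ∫⁻ ω, B q (d ω n) ∂μ ≤ 1 := by
      intro q
      have hrow : iIndepFun (fun i ω => g i (d ω n i)) μ :=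
        (hind.precomp (g := fun i => (n, i)) fun i j h => (Prod.ext_iff.1 h).2).comp
          (fun i => g i) fun i => measurable_of_countable _
      rw [show (fun ω => B q (d ω n)) = fun ω => ∏ i ∈ q, g i (d ω n i) from rfl,
        lintegral_prod_eq_prod_lintegral_of_indepFun q (fun i ω => g i (d ω n i)) hrow
          fun i => (measurable_of_countable (g i)).comp (hmeas n i)]
      exact Finset.prod_le_one' fun i _ => hg n i
    calc ∫⁻ ω, π.weight g w (d ω) (n + 1) ∂μ
        = ∑ q, ∫⁻ ω, A q (d ω) * B q (d ω n) ∂μ := by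
          simp_rw [hsplit]
          exact lintegral_finsetSum _ fun q _ => ((hA q).comp hd).mul ((hB q).comp hdn)
      _ = ∑ q, (∫⁻ ω, A q (d ω) ∂μ) * ∫⁻ ω, B q (d ω n) ∂μ :=
          Finset.sum_congr rfl fun q _ => lintegral_mul_eq_lintegral_mul_lintegral_of_indepFun
            ((hA q).comp hd) ((hB q).comp hdn)
            (indepFun_of_forall_lt hmeas hind (hA q) (hAn q) (hB q))
      _ ≤ ∑ q, ∫⁻ ω, A q (d ω) ∂μ :=
          Finset.sum_le_sum fun q _ => mul_le_of_le_one_right' (hBle q)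
      _ = ∫⁻ ω, π.weight g w (d ω) n ∂μ := by
          simp_rw [hsum]
          exact (lintegral_finsetSum _ fun q _ => (hA q).comp hd).symm
      _ ≤ 1 := ih

/-- The randomization is independent of the delays, so that it may be fixed. -/
lemma Policy.lintegral_weight_le_one (π : Policy G W) {θ : E → ℝ} {w : Ω → W}
    (hmodel : IsDelayModel μ θ w d) (g : E → ℕ → ℝ≥0∞)
    (hg : ∀ k i, ∫⁻ ω, g i (d ω k i) ∂μ ≤ 1) (n : ℕ) :
    ∫⁻ ω, π.weight g (w ω) (d ω) n ∂μ ≤ 1 := by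
  have : IsProbabilityMeasure μ := hmodel.iIndepFun_delay.isProbabilityMeasure
  have hd : Measurable d :=
    measurable_pi_lambda _ fun k => measurable_pi_lambda _ fun i => hmodel.measurable_delay k i
  have hw := hmodel.measurable_random
  have hF := π.measurable_weight g n
  have := Measure.isProbabilityMeasure_map (μ := μ) hw.aemeasurable
  have := Measure.isProbabilityMeasure_map (μ := μ) hd.aemeasurable
  calc ∫⁻ ω, π.weight g (w ω) (d ω) n ∂μ
      = ∫⁻ x, π.weight g x.1 x.2 n ∂(μ.map fun ω => (w ω, d ω)) :=
        (lintegral_map hF (hw.prodMk hd)).symm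
    _ = ∫⁻ v, ∫⁻ d', π.weight g v d' n ∂(μ.map d) ∂(μ.map w) := by
        rw [(indepFun_iff_map_prod_eq_prod_map_map hw.aemeasurable hd.aemeasurable).1
          hmodel.indepFun_random, lintegral_prod _ hF.aemeasurable]
    _ ≤ ∫⁻ _, 1 ∂(μ.map w) := by
        refine lintegral_mono fun v => ?_
        have hFv : Measurable fun d' : ℕ → E → ℕ => π.weight g v d' n :=
          hF.comp (measurable_const.prodMk measurable_id)
        rw [lintegral_map hFv hd]
        exact π.lintegral_weight_le_one_of_fixed g hmodel.measurable_delay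
          hmodel.iIndepFun_delay hg v n
    _ = 1 := by simp


/-! ### Geometric delays -/

variable {θ : E → ℝ} {w : Ω → W}

lemma tsum_ofReal_geometric {a : ℝ} (ha0 : 0 < a) (ha1 : a ≤ 1) :
    ∑' m : ℕ, ENNReal.ofReal (a * (1 - a) ^ m) = 1 := by
  have h0 : 0 ≤ 1 - a := by linarith
  have h := (hasSum_geometric_of_lt_one h0 (by linarith)).mul_left a
  rw [← ENNReal.ofReal_tsum_of_nonneg (fun m => by positivity) h.summable, h.tsum_eq]
  simp [ha0.ne']

omit [Fintype E] [DecidableEq E] in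
/-- Delays are positive because the positive values already have total probability `1`. -/
lemma IsDelayModel.measure_delay_eq_zero (hmodel : IsDelayModel μ θ w d)
    (hθ : ∀ i, 0 < θ i ∧ θ i ≤ 1) (k : ℕ) (i : E) : μ {ω | d ω k i = 0} = 0 := by
  have : IsProbabilityMeasure μ := hmodel.iIndepFun_delay.isProbabilityMeasure
  have hsum : ∑' m : ℕ, μ ((fun ω => d ω k i) ⁻¹' {m}) = 1 := by
    rw [← tsum_univ fun m : ℕ => μ ((fun ω => d ω k i) ⁻¹' {m}),
      tsum_measure_preimage_singleton Set.countable_univ fun m _ =>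
        hmodel.measurable_delay k i (measurableSet_singleton m), Set.preimage_univ, measure_univ]
  have hsplit := tsum_eq_zero_add' (f := fun m : ℕ => μ ((fun ω => d ω k i) ⁻¹' {m}))
    ENNReal.summable
  have hpos : ∑' m : ℕ, μ ((fun ω => d ω k i) ⁻¹' {m + 1}) = 1 := by
    rw [← tsum_ofReal_geometric (hθ i).1 (hθ i).2]
    exact tsum_congr fun m => hmodel.geometric k i m
  rw [hsum, hpos] at hsplit
  have h1 : (0 : ℝ≥0∞) + 1 = μ ((fun ω => d ω k i) ⁻¹' {0}) + 1 := by rw [zero_add]; exact hsplit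
  exact ((ENNReal.add_left_inj ENNReal.one_ne_top).1 h1).symm

omit [DecidableEq E] in
lemma IsDelayModel.ae_one_le_delay (hmodel : IsDelayModel μ θ w d)
    (hθ : ∀ i, 0 < θ i ∧ θ i ≤ 1) : ∀ᵐ ω ∂μ, ∀ k i, 1 ≤ d ω k i := by
  refine ae_all_iff.2 fun k => ae_all_iff.2 fun i => ?_
  rw [ae_iff]
  simpa [Nat.one_le_iff_ne_zero] using hmodel.measure_delay_eq_zero hθ k i

omit [DecidableEq E] in
lemma IsDelayModel.ae_delay_eq_one (hmodel : IsDelayModel μ θ w d)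
    (hθ : ∀ i, 0 < θ i ∧ θ i ≤ 1) : ∀ᵐ ω ∂μ, ∀ k i, θ i = 1 → d ω k i = 1 := by
  refine ae_all_iff.2 fun k => ae_all_iff.2 fun i => ?_
  by_cases hi : θ i = 1
  · have hne : ∀ m : ℕ, ∀ᵐ ω ∂μ, d ω k i ≠ m + 1 + 1 := fun m => by
      rw [ae_iff]
      simpa [hi] using hmodel.geometric k i (m + 1)
    filter_upwards [ae_all_iff.2 hne, hmodel.ae_one_le_delay hθ] with ω h1 h2 _
    by_contra hd
    have h3 := h2 k i
    exact h1 (d ω k i - 2) (by omega)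
  · exact .of_forall fun _ h => absurd h hi

/-- The likelihood ratio of a single packet with delay `m`. -/
noncomputable def packetRatio (θ u : ℝ) (m : ℕ) : ℝ≥0∞ :=
  ENNReal.ofReal (u / θ * ((1 - u) / (1 - θ)) ^ (m - 1))

omit [Fintype E] [DecidableEq E] in
lemma IsDelayModel.lintegral_packetRatio_le_one (hmodel : IsDelayModel μ θ w d)
    (hθ : ∀ i, 0 < θ i ∧ θ i ≤ 1) (k : ℕ) (i : E) {u : ℝ} (hu0 : 0 < u) (hu1 : u ≤ 1) :
    ∫⁻ ω, packetRatio (θ i) u (d ω k i) ∂μ ≤ 1 := by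
  obtain ⟨hθ0, hθ1⟩ := hθ i
  have h1u : 0 ≤ 1 - u := by linarith
  have h1θ : 0 ≤ 1 - θ i := by linarith
  have hd := hmodel.measurable_delay k i
  have hval : ∀ m, (μ.map fun ω => d ω k i) {m} = μ {ω | d ω k i = m} := fun m =>
    Measure.map_apply hd (measurableSet_singleton m)
  rw [← lintegral_map (f := packetRatio (θ i) u) (measurable_of_countable _) hd,
    lintegral_countable', tsum_eq_zero_add' ENNReal.summable, hval,
    hmodel.measure_delay_eq_zero hθ k i, mul_zero, zero_add, ← tsum_ofReal_geometric hu0 hu1]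
  refine ENNReal.tsum_le_tsum fun m => ?_
  rw [hval, hmodel.geometric, packetRatio, ← ENNReal.ofReal_mul (by positivity)]
  refine ENNReal.ofReal_le_ofReal ?_
  rw [Nat.add_sub_cancel]
  rcases hθ1.lt_or_eq with hlt | heq
  · have h : 1 - θ i ≠ 0 := by linarith
    refine le_of_eq ?_
    rw [div_pow]
    field_simp
  · rcases m with _ | m
    · simp [heq]
    · simp only [heq, sub_self, ne_eq, Nat.succ_ne_zero, not_false_eq_true, zero_pow, mul_zero]
      positivity

lemma Policy.packets_le (π : Policy G W) (w : W) (d : ℕ → E → ℕ) (n : ℕ) (i : E) :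
    π.packets w d n i ≤ n := by
  calc π.packets w d n i ≤ ∑ _k ∈ Finset.Ico 1 n, 1 :=
        Finset.sum_le_sum fun k _ => by split_ifs <;> simp
    _ ≤ n := by simp

lemma Policy.packets_le_attempts (π : Policy G W) (w : W) {d : ℕ → E → ℕ}
    (hd : ∀ k i, 1 ≤ d k i) (n : ℕ) (i : E) : π.packets w d n i ≤ π.attempts w d n i :=
  Finset.sum_le_sum fun k _ => by split_ifs <;> simp [hd]

lemma Policy.attempts_eq_zero (π : Policy G W) (w : W) {d : ℕ → E → ℕ} {n : ℕ} {i : E}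
    (h : π.packets w d n i = 0) : π.attempts w d n i = 0 := by
  refine Finset.sum_eq_zero fun k hk => ?_
  have := Finset.sum_eq_zero_iff.1 h k hk
  simp_all

lemma Policy.attempts_eq_packets (π : Policy G W) (w : W) {d : ℕ → E → ℕ} {i : E}
    (hd : ∀ k, d k i = 1) (n : ℕ) : π.attempts w d n i = π.packets w d n i :=
  Finset.sum_congr rfl fun k _ => by rw [hd]

/-- The product of the likelihood ratios of the packets on the links of `p` is the product of the
likelihood ratios of these links. -/
lemma Policy.weight_packetRatio_eq (π : Policy G W) (w : W) {d : ℕ → E → ℕ}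
    (hd : ∀ k i, 1 ≤ d k i) (p : Finset E) {u : E → ℝ} (hθ : ∀ i, 0 < θ i ∧ θ i ≤ 1)
    (hu : ∀ i, 0 < u i ∧ u i ≤ 1) (n : ℕ) :
    π.weight (fun i m => if i ∈ p then packetRatio (θ i) (u i) m else 1) w d n =
      ∏ i ∈ p, ENNReal.ofReal
        (likelihoodRatio (θ i) (u i) (π.packets w d n i) (π.attempts w d n i)) := by
  have hswap : ∀ q : Finset E, ∀ k, (∏ i ∈ q, if i ∈ p then packetRatio (θ i) (u i) (d k i) else 1)
      = ∏ i ∈ p, if i ∈ q then packetRatio (θ i) (u i) (d k i) else 1 := fun q k => by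
    rw [← Finset.prod_filter, ← Finset.prod_filter]
    refine Finset.prod_congr (Finset.ext fun i => ?_) fun _ _ => rfl
    simp [and_comm]
  simp only [Policy.weight, hswap]
  rw [Finset.prod_comm]
  refine Finset.prod_congr rfl fun i _ => ?_
  have h1 : 0 ≤ u i / θ i := div_nonneg (hu i).1.le (hθ i).1.le
  have h2 : 0 ≤ (1 - u i) / (1 - θ i) :=
    div_nonneg (sub_nonneg.2 (hu i).2) (sub_nonneg.2 (hθ i).2)
  have hsub : π.attempts w d n i - π.packets w d n i =
      ∑ k ∈ Finset.Ico 1 n, if i ∈ π.path w d k then d k i - 1 else 0 := by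
    refine Nat.sub_eq_of_eq_add ?_
    rw [Policy.attempts, Policy.packets, ← Finset.sum_add_distrib]
    refine Finset.sum_congr rfl fun k _ => ?_
    have := hd k i
    split_ifs <;> omega
  rw [likelihoodRatio, hsub, Policy.packets, ← Finset.prod_pow_eq_pow_sum,
    ← Finset.prod_pow_eq_pow_sum, ← Finset.prod_mul_distrib,
    ENNReal.ofReal_prod_of_nonneg fun k _ => by positivity]
  refine Finset.prod_congr rfl fun k _ => ?_
  split_ifs <;> simp [packetRatio]

/-! ### Concentration of the divergence along a path -/

lemma attemptsKL_nonneg {a : ℝ} (ha0 : 0 < a) (ha1 : a ≤ 1) {s t : ℕ} (hst : s ≤ t)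
    (hs : s = 0 → t = 0) (ha : a = 1 → t = s) : 0 ≤ attemptsKL a s t := by
  rcases Nat.eq_zero_or_pos s with h0 | h0
  · simp [attemptsKL, hs h0]
  have hs' : (0 : ℝ) < s := by exact_mod_cast h0
  have hst' : (s : ℝ) ≤ t := by exact_mod_cast hst
  rcases ha1.lt_or_eq with ha1 | ha1
  · rw [attemptsKL_eq_mul_klGeom ha0 ha1 h0 hst]
    refine mul_nonneg hs'.le ?_
    rw [← klGeom_self a]
    have hpos : (0 : ℝ) < s / t := div_pos hs' (by linarith)
    rcases le_total (s / t : ℝ) a with h | h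
    · exact antitoneOn_klGeom ha1 ⟨hpos, h⟩ ⟨ha0, le_rfl⟩ h
    · exact monotoneOn_klGeom ha0 ⟨le_rfl, ha1.le⟩ ⟨h, div_le_one_of_le₀ hst' (by linarith)⟩ h
  · simp [attemptsKL, ha ha1, ha1, div_self hs'.ne']

lemma ofReal_mul_klBer_eq {a : ℝ} (ha0 : 0 < a) {s t : ℕ}
    (hs : s = 0 → t = 0) (ha : a = 1 → t = s) :
    ENNReal.ofReal t * klBer (s / t : ℝ) a = ENNReal.ofReal (attemptsKL a s t) := by
  rcases Nat.eq_zero_or_pos t with rfl | ht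
  · simp [attemptsKL]
  have hs0 : (s : ℝ) ≠ 0 := by
    intro h
    have := hs (by exact_mod_cast h)
    omega
  have hcond : ¬((a = 1 ∧ (s / t : ℝ) ≠ 1) ∨ (a = 0 ∧ (s / t : ℝ) ≠ 0)) := by
    rintro (⟨h1, h2⟩ | ⟨h1, -⟩)
    · exact h2 (by rw [ha h1, div_self hs0])
    · exact ha0.ne' h1
  rw [klBer, if_neg hcond, ← ENNReal.ofReal_mul (by positivity), attemptsKL]

lemma le_sum_min {ι : Type*} {p : Finset ι} {x : ι → ℝ} {δ : ℝ} (hδ : 0 ≤ δ)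
    (hx : ∀ i ∈ p, 0 ≤ x i) (h : δ ≤ ∑ i ∈ p, x i) : δ ≤ ∑ i ∈ p, min δ (x i) := by
  by_cases hex : ∃ i ∈ p, δ ≤ x i
  · obtain ⟨i, hi, hle⟩ := hex
    calc δ = min δ (x i) := (min_eq_left hle).symm
      _ ≤ _ := Finset.single_le_sum (f := fun i => min δ (x i))
        (fun j hj => le_min hδ (hx j hj)) hi
  · push Not at hex
    rwa [Finset.sum_congr rfl fun i hi => min_eq_right (hex i hi).le]

/-- The concentration inequality for the divergence of the empirical parameters of the links of
`p`, at a fixed time and with an adaptive choice of the paths. -/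
theorem Policy.measure_le_sum_klBer_le (π : Policy G W) (hmodel : IsDelayModel μ θ w d)
    (hθ : ∀ i, 0 < θ i ∧ θ i ≤ 1) {n : ℕ} (hn : 1 ≤ n) (p : Finset E) {δ : ℝ} (hδ : 1 ≤ δ) :
    μ {ω | ENNReal.ofReal δ ≤ ∑ i ∈ p, ENNReal.ofReal (π.attempts (w ω) (d ω) n i : ℝ) *
        klBer (π.empirical (w ω) (d ω) n i) (θ i)} ≤
      ENNReal.ofReal ((2 * ((δ + 1) * Real.log (δ * n)) + 3) ^ p.card *
        Real.exp (p.card - δ)) := by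
  choose D hDcard hDmem hD using fun i =>
    exists_finset_exp_le_likelihoodRatio (N := n) (hθ i).1 (hθ i).2 hδ hn
  let g : (E → ℝ) → E → ℕ → ℝ≥0∞ := fun u i m =>
    if i ∈ p then packetRatio (θ i) (u i) m else 1
  let U : Finset (E → ℝ) := Fintype.piFinset fun i => if i ∈ p then D i else {θ i}
  have hU : ∀ u ∈ U, ∀ i, 0 < u i ∧ u i ≤ 1 := by
    intro u hu i
    have h := Fintype.mem_piFinset.1 hu i
    split_ifs at h with hi
    · exact hDmem i _ h
    · rw [Finset.mem_singleton.1 h]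
      exact hθ i
  set ε : ℝ≥0∞ := ENNReal.ofReal (Real.exp (δ - p.card)) with hε
  have hmarkov : ∀ u ∈ U, μ {ω | ε ≤ π.weight (g u) (w ω) (d ω) n} ≤ ε⁻¹ := by
    intro u hu
    have hpair : Measurable fun ω => (w ω, d ω) := hmodel.measurable_random.prodMk
      (measurable_pi_lambda _ fun k => measurable_pi_lambda _ fun i => hmodel.measurable_delay k i)
    have hmeas := (π.measurable_weight (g u) n).comp hpair
    have : IsProbabilityMeasure μ := hmodel.iIndepFun_delay.isProbabilityMeasure
    refine (meas_ge_le_lintegral_div hmeas.aemeasurable (by simp [Real.exp_pos])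
      ENNReal.ofReal_ne_top).trans ?_
    rw [ENNReal.div_eq_inv_mul]
    refine mul_le_of_le_one_right' (π.lintegral_weight_le_one hmodel (g u) (fun k i => ?_) n)
    by_cases hi : i ∈ p
    · simpa only [g, hi, if_true] using
        hmodel.lintegral_packetRatio_le_one hθ k i (hU u hu i).1 (hU u hu i).2
    · simp [g, hi]
  have hcover : ∀ᵐ ω ∂μ, ω ∈ {ω | ENNReal.ofReal δ ≤ ∑ i ∈ p,
        ENNReal.ofReal (π.attempts (w ω) (d ω) n i : ℝ) *
          klBer (π.empirical (w ω) (d ω) n i) (θ i)} →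
      ω ∈ ⋃ u ∈ U, {ω | ε ≤ π.weight (g u) (w ω) (d ω) n} := by
    filter_upwards [hmodel.ae_one_le_delay hθ, hmodel.ae_delay_eq_one hθ] with ω h1 h2 hω
    have hst := π.packets_le_attempts (w ω) h1 n
    have hs0 : ∀ i, π.packets (w ω) (d ω) n i = 0 → π.attempts (w ω) (d ω) n i = 0 :=
      fun i => π.attempts_eq_zero (w ω)
    have hθ1 : ∀ i, θ i = 1 → π.attempts (w ω) (d ω) n i = π.packets (w ω) (d ω) n i :=
      fun i hi => π.attempts_eq_packets (w ω) (fun k => h2 k i hi) n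
    choose v hvD hv using fun i => hD i _ _ (π.packets_le (w ω) (d ω) n i) (hst i) (hs0 i) (hθ1 i)
    set x : E → ℝ := fun i =>
      attemptsKL (θ i) (π.packets (w ω) (d ω) n i) (π.attempts (w ω) (d ω) n i) with hx
    have hx0 : ∀ i, 0 ≤ x i := fun i =>
      attemptsKL_nonneg (hθ i).1 (hθ i).2 (hst i) (hs0 i) (hθ1 i)
    have hsum : δ ≤ ∑ i ∈ p, x i := by
      have hω' : ENNReal.ofReal δ ≤ ∑ i ∈ p,
        ENNReal.ofReal (π.attempts (w ω) (d ω) n i : ℝ) *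
          klBer (π.empirical (w ω) (d ω) n i) (θ i) := hω
      have hterm : ∀ i ∈ p, ENNReal.ofReal (π.attempts (w ω) (d ω) n i : ℝ) *
          klBer (π.empirical (w ω) (d ω) n i) (θ i) = ENNReal.ofReal (x i) := fun i _ =>
        ofReal_mul_klBer_eq (hθ i).1 (hs0 i) (hθ1 i)
      rw [Finset.sum_congr rfl hterm, ← ENNReal.ofReal_sum_of_nonneg fun i _ => hx0 i] at hω'
      exact (ENNReal.ofReal_le_ofReal_iff (Finset.sum_nonneg fun i _ => hx0 i)).1 hω'
    have hmin := le_sum_min (by linarith) (fun i _ => hx0 i) hsum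
    set u : E → ℝ := fun i => if i ∈ p then v i else θ i with hu
    have huU : u ∈ U := by
      refine Fintype.mem_piFinset.2 fun i => ?_
      by_cases hi : i ∈ p
      · simpa [hu, hi] using hvD i
      · simp [hu, hi]
    refine Set.mem_iUnion₂.2 ⟨u, huU, ?_⟩
    have hw : π.weight (g u) (w ω) (d ω) n = _ :=
      π.weight_packetRatio_eq (w ω) h1 p hθ (hU u huU) n
    rw [Set.mem_ofPred_eq, hw]
    calc ε ≤ ENNReal.ofReal (Real.exp (∑ i ∈ p, (min δ (x i) - 1))) := by
          refine ENNReal.ofReal_le_ofReal (Real.exp_le_exp.2 ?_)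
          rw [Finset.sum_sub_distrib]
          simpa using hmin
      _ = ∏ i ∈ p, ENNReal.ofReal (Real.exp (min δ (x i) - 1)) := by
          rw [Real.exp_sum, ENNReal.ofReal_prod_of_nonneg fun i _ => (Real.exp_pos _).le]
      _ ≤ _ := by
          refine Finset.prod_le_prod' fun i hi => ENNReal.ofReal_le_ofReal ?_
          simpa only [hu, hi, if_true] using hv i
  have hcardU : (U.card : ℝ) ≤ (2 * ((δ + 1) * Real.log (δ * n)) + 3) ^ p.card := by
    have h : U.card = ∏ i ∈ p, (D i).card := by
      rw [Fintype.card_piFinset, ← Finset.prod_subset (Finset.subset_univ p)]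
      · exact Finset.prod_congr rfl fun i hi => by rw [if_pos hi]
      · intro i _ hi
        rw [if_neg hi, Finset.card_singleton]
    rw [h, Nat.cast_prod]
    exact (Finset.prod_le_prod (fun i _ => Nat.cast_nonneg _) fun i _ => hDcard i).trans_eq
      (Finset.prod_const _)
  calc _ ≤ μ (⋃ u ∈ U, {ω | ε ≤ π.weight (g u) (w ω) (d ω) n}) := measure_mono_ae hcover
    _ ≤ ∑ u ∈ U, μ {ω | ε ≤ π.weight (g u) (w ω) (d ω) n} := measure_biUnion_finset_le _ _
    _ ≤ ∑ _u ∈ U, ε⁻¹ := Finset.sum_le_sum hmarkov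
    _ = ENNReal.ofReal (U.card * Real.exp (p.card - δ)) := by
        rw [Finset.sum_const, nsmul_eq_mul, hε, ← ENNReal.ofReal_inv_of_pos (Real.exp_pos _),
          ← Real.exp_neg, neg_sub, ENNReal.ofReal_mul (Nat.cast_nonneg _), ENNReal.ofReal_natCast]
    _ ≤ _ := ENNReal.ofReal_le_ofReal (by gcongr)

end Model


/-! ### From the concentration inequality to the index -/

lemma indexB_le_pathDelay {E : Type*} {H n : ℕ} {p : Finset E} {t x θ : E → ℝ}
    (hθ : ∀ i, 0 < θ i ∧ θ i ≤ 1)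
    (h : ((∑ i ∈ p, ENNReal.ofReal (t i) * klBer (x i) (θ i) : ℝ≥0∞) : EReal) ≤ f1 H n) :
    indexB H p n t x ≤ ((pathDelay p θ : ℝ) : EReal) :=
  sInf_le ⟨θ, hθ, h, rfl⟩

lemma tendsto_klBer_nhdsGT (a : ℝ) {b : ℝ} (hb0 : 0 < b) (hb1 : b < 1) :
    Filter.Tendsto (klBer a) (nhdsWithin b (Set.Ioi b)) (nhds (klBer a b)) := by
  have hne : ∀ v : ℝ, 0 < v → v < 1 → klBer a v =
      ENNReal.ofReal (a * Real.log (a / v) + (1 - a) * Real.log ((1 - a) / (1 - v))) := by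
    intro v h0 h1
    rw [klBer, if_neg]
    rintro (⟨h, -⟩ | ⟨h, -⟩) <;> linarith
  have hlog : ∀ (c : ℝ) (f : ℝ → ℝ), ContinuousAt f b → 0 < f b →
      ContinuousAt (fun v => c * Real.log (c / f v)) b := by
    intro c f hf hfb
    rcases eq_or_ne c 0 with rfl | hc
    · simpa using continuousAt_const
    · exact ((continuousAt_const.div hf hfb.ne').log (div_ne_zero hc hfb.ne')).const_mul c
  have hcont : ContinuousAt (fun v : ℝ => ENNReal.ofReal
      (a * Real.log (a / v) + (1 - a) * Real.log ((1 - a) / (1 - v)))) b :=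
    ENNReal.continuous_ofReal.continuousAt.comp
      ((hlog a id continuousAt_id hb0).add
        (hlog (1 - a) (fun v => 1 - v) (continuousAt_const.sub continuousAt_id) (by linarith)))
  rw [hne b hb0 hb1]
  refine (hcont.tendsto.mono_left nhdsWithin_le_nhds).congr' ?_
  filter_upwards [Ioo_mem_nhdsGT hb1] with v hv
  exact (hne v (hb0.trans hv.1) hv.2).symm

/-- If the constraint is strictly satisfied by `θ`, then it is also satisfied by a parameter with a
slightly larger coordinate, which has a smaller average delay. -/
lemma indexB_lt_pathDelay {E : Type*} {H n : ℕ} {p : Finset E} {t x θ : E → ℝ}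
    (hθ : ∀ i, 0 < θ i ∧ θ i ≤ 1) (hex : ∃ i ∈ p, θ i < 1)
    (h : ((∑ i ∈ p, ENNReal.ofReal (t i) * klBer (x i) (θ i) : ℝ≥0∞) : EReal) < f1 H n) :
    indexB H p n t x < ((pathDelay p θ : ℝ) : EReal) := by
  classical
  obtain ⟨j, hj, hj1⟩ := hex
  have htend : Filter.Tendsto (fun v => ((∑ i ∈ p, ENNReal.ofReal (t i) *
      klBer (x i) (Function.update θ j v i) : ℝ≥0∞) : EReal)) (nhdsWithin (θ j) (Set.Ioi (θ j)))
      (nhds ((∑ i ∈ p, ENNReal.ofReal (t i) * klBer (x i) (θ i) : ℝ≥0∞) : EReal)) := by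
    refine (EReal.continuous_coe_ennreal_iff.2 continuous_id).continuousAt.tendsto.comp
      (tendsto_finsetSum _ fun i _ => ?_)
    rcases eq_or_ne i j with rfl | hij
    · simp only [Function.update_self]
      exact ENNReal.Tendsto.const_mul (tendsto_klBer_nhdsGT _ (hθ i).1 hj1)
        (.inr ENNReal.ofReal_ne_top)
    · simp only [Function.update_of_ne hij]
      exact tendsto_const_nhds
  obtain ⟨v, hv, hvlt⟩ := ((Ioo_mem_nhdsGT hj1 : Set.Ioo (θ j) 1 ∈ _) |> fun hmem =>
    (Filter.eventually_of_mem hmem fun v hv => hv).and (htend.eventually_lt_const h)).exists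
  have hu : ∀ i, 0 < Function.update θ j v i ∧ Function.update θ j v i ≤ 1 := by
    intro i
    rcases eq_or_ne i j with rfl | hij
    · simpa using ⟨(hθ i).1.trans hv.1, hv.2.le⟩
    · simpa [Function.update_of_ne hij] using hθ i
  refine (indexB_le_pathDelay hu hvlt.le).trans_lt (EReal.coe_lt_coe_iff.2 ?_)
  refine Finset.sum_lt_sum (fun i _ => ?_) ⟨j, hj, ?_⟩
  · rcases eq_or_ne i j with rfl | hij
    · simpa using inv_anti₀ (hθ i).1 hv.1.le
    · rw [Function.update_of_ne hij]
  · simpa using inv_strictAnti₀ (hθ j).1 hv.1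

/-- The constant `K_H` of the concentration bound. -/
noncomputable def confidenceConst (H : ℕ) : ℝ :=
  ((2 * (2 + 4 * H) ^ 2 + 3) * Real.exp 1) ^ H

lemma one_le_confidenceConst (H : ℕ) : 1 ≤ confidenceConst H := by
  refine one_le_pow₀ (one_le_mul_of_one_le_of_one_le ?_ (Real.one_le_exp zero_le_one))
  have : 0 ≤ 2 * (2 + 4 * (H : ℝ)) ^ 2 := by positivity
  linarith

/-- The factor `(log n) ^ (4 H)` in `exp (f₁ n)` outweighs the size `(C (log n) ^ 2) ^ H` of the
family of parameters, and leaves `(log n) ^ (2 H) ≥ (log n) ^ 2`. -/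
lemma card_mul_exp_le {H h n : ℕ} (hH : 1 ≤ H) (hh : h ≤ H) (hn : 3 ≤ n) {δ : ℝ}
    (hδ : δ = Real.log n + 4 * H * Real.log (Real.log n)) :
    (2 * ((δ + 1) * Real.log (δ * n)) + 3) ^ h * Real.exp (h - δ) ≤
      confidenceConst H * (n : ℝ)⁻¹ * (Real.log n ^ 2)⁻¹ := by
  have hn0 : (0 : ℝ) < n := by exact_mod_cast (by omega : 0 < n)
  have hL := one_le_log_natCast hn
  set L := Real.log n with hLdef
  have hL0 : 0 < L := by linarith
  have hlogL0 := Real.log_nonneg hL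
  have hlogL : Real.log L ≤ L - 1 := Real.log_le_sub_one_of_pos hL0
  have hδ1 : 1 ≤ δ := by
    have : 0 ≤ 4 * (H : ℝ) * Real.log L := by positivity
    linarith
  have hδL : δ + 1 ≤ (2 + 4 * H) * L := by
    have : 4 * (H : ℝ) * Real.log L ≤ 4 * H * L := by gcongr; linarith
    linarith
  have hlogδ : Real.log (δ * n) ≤ (2 + 4 * H) * L := by
    rw [Real.log_mul (by linarith) hn0.ne', ← hLdef]
    have h1 := Real.log_le_sub_one_of_pos (by linarith : 0 < δ)
    have : 4 * (H : ℝ) * Real.log L ≤ 4 * H * (L - 1) := by gcongr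
    have : (1 : ℝ) ≤ H := by exact_mod_cast hH
    linarith
  have hlogδ0 : 0 ≤ Real.log (δ * n) := by
    have : (1 : ℝ) ≤ n := by exact_mod_cast (by omega : 1 ≤ n)
    exact Real.log_nonneg (one_le_mul_of_one_le_of_one_le hδ1 this)
  set C : ℝ := 2 * (2 + 4 * H) ^ 2 + 3 with hC
  have hC1 : 1 ≤ C := by
    have : 0 ≤ 2 * (2 + 4 * (H : ℝ)) ^ 2 := by positivity
    linarith
  have hB : 2 * ((δ + 1) * Real.log (δ * n)) + 3 ≤ C * L ^ 2 := by
    have h1 : (δ + 1) * Real.log (δ * n) ≤ ((2 + 4 * H) * L) * ((2 + 4 * H) * L) := by gcongr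
    have h2 : 1 ≤ L ^ 2 := one_le_pow₀ hL
    rw [hC]
    linarith
  have hCL : 1 ≤ C * L ^ 2 := one_le_mul_of_one_le_of_one_le hC1 (one_le_pow₀ hL)
  have hexpδ : Real.exp δ = n * (L ^ H) ^ 4 := by
    rw [hδ, Real.exp_add, hLdef, Real.exp_log hn0, ← hLdef, ← pow_mul,
      show 4 * (H : ℝ) * Real.log L = ((H * 4 : ℕ) : ℝ) * Real.log L by push_cast; ring,
      Real.exp_nat_mul, Real.exp_log hL0]
  have hexp : Real.exp (h - δ) ≤ Real.exp 1 ^ H * (n * (L ^ H) ^ 4)⁻¹ := by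
    rw [Real.exp_sub, hexpδ, div_eq_mul_inv, ← Real.exp_nat_mul, mul_one]
    gcongr
  have hLH : L ^ 2 ≤ (L ^ H) ^ 2 := by
    gcongr
    exact le_self_pow₀ hL (by omega)
  calc (2 * ((δ + 1) * Real.log (δ * n)) + 3) ^ h * Real.exp (h - δ)
      ≤ (C * L ^ 2) ^ h * (Real.exp 1 ^ H * (n * (L ^ H) ^ 4)⁻¹) := by gcongr
    _ ≤ (C * L ^ 2) ^ H * (Real.exp 1 ^ H * (n * (L ^ H) ^ 4)⁻¹) := by gcongr
    _ = (C * Real.exp 1) ^ H * (n : ℝ)⁻¹ * ((L ^ H) ^ 2)⁻¹ := by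
        have : L ^ H ≠ 0 := by positivity
        rw [mul_pow, mul_pow, ← pow_mul, mul_comm 2 H, pow_mul]
        field_simp
    _ ≤ (C * Real.exp 1) ^ H * (n : ℝ)⁻¹ * (L ^ 2)⁻¹ := by gcongr

/-- Up to `n = 2` the bound is not informative. -/
lemma one_le_bound {H n : ℕ} (hn1 : 1 ≤ n) (hn2 : n ≤ 2) :
    1 ≤ ENNReal.ofReal (confidenceConst H) * (n : ENNReal)⁻¹ *
      (ENNReal.ofReal (Real.log n) ^ 2)⁻¹ := by
  have hK : 1 ≤ ENNReal.ofReal (confidenceConst H) := by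
    simpa using one_le_confidenceConst H
  interval_cases n
  · have : ENNReal.ofReal (confidenceConst H) ≠ 0 := (zero_lt_one.trans_le hK).ne'
    simp [ENNReal.mul_top this]
  · have hlog : (2 : ℝ) * Real.log (2 : ℕ) ^ 2 ≤ 1 := by
      push_cast
      nlinarith [Real.log_two_lt_d9, Real.log_two_gt_d9]
    have h2 : ((2 : ℕ) : ENNReal) * ENNReal.ofReal (Real.log (2 : ℕ)) ^ 2 ≤ 1 := by
      have hlog0 : 0 ≤ Real.log (2 : ℕ) := Real.log_natCast_nonneg 2
      rw [← ENNReal.ofReal_pow hlog0, ← ENNReal.ofReal_natCast 2,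
        ← ENNReal.ofReal_mul (by positivity)]
      exact ENNReal.ofReal_le_one.2 (by exact_mod_cast hlog)
    rw [mul_assoc, ← ENNReal.mul_inv (by simp) (by simp)]
    exact one_le_mul hK (ENNReal.one_le_inv.2 h2)

lemma card_le_maxLength {V E : Type*} [Fintype E] {G : Network V E} {p : Finset E}
    (hp : p ∈ G.paths) : p.card ≤ G.maxLength :=
  Finset.le_sup (f := Finset.card) hp

variable {V E : Type*} [Fintype E] [DecidableEq E] {G : Network V E}
  {W : Type*} [MeasurableSpace W] {Ω : Type*} [MeasurableSpace Ω] {μ : Measure Ω}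
  {θ : E → ℝ} {w : Ω → W} {d : Ω → ℕ → E → ℕ}

lemma Policy.measure_f1_le_sum_klBer_le (π : Policy G W) (hmodel : IsDelayModel μ θ w d)
    (hθ : ∀ i, 0 < θ i ∧ θ i ≤ 1) {n H : ℕ} (hn : 1 ≤ n) {p : Finset E} (hne : p.Nonempty)
    (hp : p.card ≤ H) :
    μ {ω | f1 H n ≤ ((∑ i ∈ p, ENNReal.ofReal (π.attempts (w ω) (d ω) n i : ℝ) *
        klBer (π.empirical (w ω) (d ω) n i) (θ i) : ℝ≥0∞) : EReal)} ≤
      ENNReal.ofReal (confidenceConst H) * (n : ENNReal)⁻¹ *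
        (ENNReal.ofReal (Real.log n) ^ 2)⁻¹ := by
  have : IsProbabilityMeasure μ := hmodel.iIndepFun_delay.isProbabilityMeasure
  rcases Nat.lt_or_ge 2 n with hn3 | hn2
  · have hH : 1 ≤ H := hne.card_pos.trans_le hp
    have hL := one_le_log_natCast hn3
    set δ : ℝ := Real.log n + 4 * H * Real.log (Real.log n) with hδ
    have hδ1 : 1 ≤ δ := by
      have h1 := Real.log_nonneg hL
      have : 0 ≤ 4 * (H : ℝ) * Real.log (Real.log n) := by positivity
      linarith
    have hset : ∀ S : ℝ≥0∞, f1 H n ≤ (S : EReal) ↔ ENNReal.ofReal δ ≤ S := by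
      intro S
      rw [f1_eq_coe H hn3.le, ← EReal.coe_ennreal_le_coe_ennreal_iff, EReal.coe_ennreal_ofReal,
        max_eq_left (by linarith)]
    simp only [hset]
    have hn0 : (0 : ℝ) < n := by exact_mod_cast hn
    have hbound : ENNReal.ofReal (confidenceConst H * (n : ℝ)⁻¹ * (Real.log n ^ 2)⁻¹) =
        ENNReal.ofReal (confidenceConst H) * (n : ENNReal)⁻¹ *
          (ENNReal.ofReal (Real.log n) ^ 2)⁻¹ := by
      have hK := one_le_confidenceConst H
      rw [ENNReal.ofReal_mul (by positivity), ENNReal.ofReal_mul (by positivity),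
        ENNReal.ofReal_inv_of_pos hn0, ENNReal.ofReal_inv_of_pos (by positivity),
        ENNReal.ofReal_natCast, ENNReal.ofReal_pow (by positivity)]
    rw [← hbound]
    exact (π.measure_le_sum_klBer_le hmodel hθ hn p hδ1).trans
      (ENNReal.ofReal_le_ofReal (card_mul_exp_le hH hp hn3 hδ))
  · exact prob_le_one.trans (one_le_bound hn hn2)

lemma Policy.measure_lt_indexB_le (π : Policy G W) (hmodel : IsDelayModel μ θ w d)
    (hθ : ∀ i, 0 < θ i ∧ θ i ≤ 1) {n H : ℕ} (hn : 1 ≤ n) {p : Finset E} (hp : p.card ≤ H) :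
    μ {ω | ((pathDelay p θ : ℝ) : EReal) < indexB H p n
        (fun i => (π.attempts (w ω) (d ω) n i : ℝ)) (π.empirical (w ω) (d ω) n)} ≤
      ENNReal.ofReal (confidenceConst H) * (n : ENNReal)⁻¹ *
        (ENNReal.ofReal (Real.log n) ^ 2)⁻¹ := by
  have : IsProbabilityMeasure μ := hmodel.iIndepFun_delay.isProbabilityMeasure
  rcases p.eq_empty_or_nonempty with rfl | hne
  · rcases Nat.lt_or_ge 2 n with hn3 | hn2
    · -- The constraint is empty, and the confidence level is nonnegative.
      have hf : 0 ≤ f1 H n := by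
        have hL := one_le_log_natCast hn3
        have h1 := Real.log_nonneg hL
        rw [f1_eq_coe H hn3.le]
        exact EReal.coe_nonneg.2 (by positivity)
      have hle : ∀ ω, indexB H ∅ n (fun i => (π.attempts (w ω) (d ω) n i : ℝ))
          (π.empirical (w ω) (d ω) n) ≤ ((pathDelay ∅ θ : ℝ) : EReal) := fun ω =>
        indexB_le_pathDelay hθ (by simpa using hf)
      simp [fun ω => (hle ω).not_gt]
    · exact prob_le_one.trans (one_le_bound hn hn2)
  · refine (measure_mono fun ω hω => ?_).trans
      (π.measure_f1_le_sum_klBer_le hmodel hθ hn hne hp)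
    rw [Set.mem_ofPred_eq] at hω ⊢
    by_contra! hlt
    exact (indexB_le_pathDelay hθ hlt.le).not_gt hω

lemma Policy.measure_le_indexB_le (π : Policy G W) (hmodel : IsDelayModel μ θ w d)
    (hθ : ∀ i, 0 < θ i ∧ θ i ≤ 1) {n H : ℕ} (hn : 1 ≤ n) {p : Finset E} (hp : p.card ≤ H)
    (hex : ∃ i ∈ p, θ i < 1) :
    μ {ω | ((pathDelay p θ : ℝ) : EReal) ≤ indexB H p n
        (fun i => (π.attempts (w ω) (d ω) n i : ℝ)) (π.empirical (w ω) (d ω) n)} ≤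
      ENNReal.ofReal (confidenceConst H) * (n : ENNReal)⁻¹ *
        (ENNReal.ofReal (Real.log n) ^ 2)⁻¹ := by
  obtain ⟨i, hi, -⟩ := id hex
  refine (measure_mono fun ω hω => ?_).trans
    (π.measure_f1_le_sum_klBer_le hmodel hθ hn ⟨i, hi⟩ hp)
  rw [Set.mem_ofPred_eq] at hω ⊢
  by_contra! hlt
  exact (indexB_lt_pathDelay hθ hex hlt).not_ge hω

end Routing

open Routing in
theorem theorem4 :
    (∀ (V E : Type*) [Fintype E] (G : Network V E) (n : ℕ) (p : Finset E) (s t x : E → ℝ),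
      1 ≤ n → p ∈ G.paths →
      (∀ i ∈ p, 0 < x i ∧ x i ≤ 1) → (∀ i ∈ p, 0 ≤ t i ∧ s i = t i * x i) →
      indexC G.maxLength p n s x ≤ indexB G.maxLength p n t x) ∧
    ∃ K : ℕ → ℝ, (∀ H, 0 < K H) ∧
      ∀ (V E W Ω : Type*) [Fintype E] [DecidableEq E] [MeasurableSpace W] [MeasurableSpace Ω]
        (G : Network V E) (π : Policy G W) (μ : Measure Ω) [IsProbabilityMeasure μ]
        (θ : E → ℝ) (w : Ω → W) (d : Ω → ℕ → E → ℕ),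
        (∀ i, 0 < θ i ∧ θ i ≤ 1) → IsDelayModel μ θ w d →
        ∀ (n : ℕ) (p : Finset E), 1 ≤ n → p ∈ G.paths →
          (μ {ω | ((pathDelay p θ : ℝ) : EReal) <
              indexB G.maxLength p n (fun i => (π.attempts (w ω) (d ω) n i : ℝ))
                (π.empirical (w ω) (d ω) n)} ≤
            ENNReal.ofReal (K G.maxLength) * (n : ENNReal)⁻¹ *
              (ENNReal.ofReal (Real.log n) ^ 2)⁻¹) ∧
          ((∃ i ∈ p, θ i < 1) →
            μ {ω | ((pathDelay p θ : ℝ) : EReal) ≤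
              indexB G.maxLength p n (fun i => (π.attempts (w ω) (d ω) n i : ℝ))
                (π.empirical (w ω) (d ω) n)} ≤
            ENNReal.ofReal (K G.maxLength) * (n : ENNReal)⁻¹ *
              (ENNReal.ofReal (Real.log n) ^ 2)⁻¹) := by
  refine ⟨fun V E _ G n p s t x hn hp hx hst => indexC_le_indexB hn (card_le_maxLength hp) hx hst,
    confidenceConst, fun H => zero_lt_one.trans_le (one_le_confidenceConst H), ?_⟩
  intro V E W Ω _ _ _ _ G π μ _ θ w d hθ hmodel n p hn hp
  exact ⟨π.measure_lt_indexB_le hmodel hθ hn (card_le_maxLength hp),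
    π.measure_le_indexB_le hmodel hθ hn (card_le_maxLength hp)⟩
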